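/- Let $\mathbb{C}$ be a small category and let $(\mathbb{C},p)$ be a natural model: $\mathbb{C}$ has a chosen terminal object $\diamond$, $p:\dot{\mathcal U}\to\mathcal U$ is a map of presheaves of sets on $\mathbb{C}$, and for every object $\Gamma$ and every $A\in\mathcal U(\Gamma)$ there are a chosen object $\Gamma.A$, a morphism $\mathsf p_A:\Gamma.A\to\Gamma$ and an element $\mathsf q_A\in\dot{\mathcal U}(\Gamma.A)$ such that the square with sides $\mathsf q_A:\mathsf y(\Gamma.A)\to\dot{\mathcal U}$, $\mathsf y(\mathsf p_A):\mathsf y(\Gamma.A)\to\mathsf y(\Gamma)$, $p$ and $A:\mathsf y(\Gamma)\to\mathcal U$ is a pullback. Elements of $\mathcal U(\Gamma)$ are the types in context $\Gamma$, elements $a\in\dot{\mathcal U}(\Gamma)$ with $p_\Gamma(a)=A$ are the terms of type $A$, and morphisms of $\mathbb{C}$ act as substitutions. Say that $(\mathbb{C},p)$ *supports* unit types, dependent sum types or dependent product types if there are operations on types and terms, strictly stable under substitution, that satisfy the following rules: * unit types: a type $\mathbf 1$ in each context, a term $\star:\mathbf 1$, and $t=\star$ for each term $t:\mathbf 1$;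 * dependent sum types: for $A\in\mathcal U(\Gamma)$ and $B\in\mathcal U(\Gamma.A)$ a type $\Sigma(A,B)\in\mathcal U(\Gamma)$; pairs $\langle a,b\rangle:\Sigma(A,B)$ for $a:A$ and $b:B[a]$; projections $\mathrm{fst}(c):A$ and $\mathrm{snd}(c):B[\mathrm{fst}(c)]$ for $c:\Sigma(A,B)$; and the equations $\mathrm{fst}\langle a,b\rangle=a$, $\mathrm{snd}\langle a,b\rangle=b$, $\langle\mathrm{fst}(c),\mathrm{snd}(c)\rangle=c$; * dependent product types: for $A\in\mathcal U(\Gamma)$ and $B\in\mathcal U(\Gamma.A)$ a type $\Pi(A,B)\in\mathcal U(\Gamma)$; abstractions $\lambda(b):\Pi(A,B)$ for terms $b:B$ in context $\Gamma.A$; applications $\mathrm{app}(f,a):B[a]$ for $f:\Pi(A,B)$ and $a:A$; and the equations $\mathrm{app}(\lambda(b),a)=b[a]$ and $\lambda(\mathrm{app}(f[\mathsf p_A],\mathsf q_A))=f$. Fix any locally cartesian closed structure on the presheaf category $\mathcal E=\widehat{\mathbb{C}}=\mathbf{Set}^{\mathbb{C}^{\mathrm{op}}}$: for each morphism $f$ a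 choice of adjoints $\Sigma_f\dashv\Delta_f\dashv\Pi_f$, where $\Sigma_f$ is postcomposition with $f$ and $\Delta_f$ is pullback along $f$, and a terminal object $1$. A polynomial from $I$ to $J$ is a diagram $I\xleftarrow{s}B\xrightarrow{f}A\xrightarrow{t}J$ in $\mathcal E$. A morphism of polynomials from $(s,f,t)$ to $(u,g,v)$, where $I\xleftarrow{u}D\xrightarrow{g}C\xrightarrow{v}J$, consists of a morphism $\varphi_0:A\to C$ with $v\varphi_0=t$, a pullback $A\leftarrow D_\varphi\xrightarrow{\varphi_1}D$ of $\varphi_0$ and $g$, and a morphism $\varphi_2:D_\varphi\to B$ such that $f\varphi_2$ is the projection $D_\varphi\to A$ and $s\varphi_2=u\varphi_1$; it is cartesian if $\varphi_2$ is invertible. Write $i_1$ for the identity polynomial on $1$ (all three morphisms are $\mathrm{id}_1$), and regard each morphism $f:B\to A$ of $\mathcal E$ as the polynomial $1\leftarrow B\xrightarrow{f}A\to 1$. Let $P_f=\Sigma_t\Pi_f\Delta_s:\mathcal E\simeq\mathcal E/1\to\mathcal E/1\simeq\mathcal E$ be its extension, where $s:B\to1$ and $t:A\to1$. The composite $p\cdot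 p$ is the following polynomial: let $h:\mathcal H\to\dot{\mathcal U}$ be the pullback of $\mathcal U\to1$ along $\dot{\mathcal U}\to1$, let $w=\Pi_p(h):M\to\mathcal U$, let $q:Q\to M$ be the pullback of $p$ along $w$, let $e:Q\to\mathcal H$ be the component at $h$ of the counit of $\Delta_p\dashv\Pi_p$, and let $r:N\to Q$ be the pullback of $p$ along the composite $Q\xrightarrow{e}\mathcal H\to\mathcal U$; then $p\cdot p$ is $1\leftarrow N\xrightarrow{q\circ r}M\to1$. Then: 1. $(\mathbb{C},p)$ supports unit types if and only if there is a cartesian morphism of polynomials $\eta:i_1\Rightarrow p$; 2. $(\mathbb{C},p)$ supports dependent sum types if and only if there is a cartesian morphism of polynomials $\mu:p\cdot p\Rightarrow p$; 3. $(\mathbb{C},p)$ supports dependent product types if and only if there is a cartesian morphism of polynomials $\zeta:P_p(p)\Rightarrow p$. -/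

import Mathlib

open CategoryTheory Opposite Limits

universe v u

namespace NaturalModels

/-! ### Polynomials in a locally cartesian closed category -/

/-- The structure of a locally cartesian closed category: chosen pullback functors `Δ_f`, right
adjoint to postcomposition `Σ_f`, chosen right adjoints `Π_f` of the functors `Δ_f`, and a chosen
terminal object. -/
class LocallyCartesianClosed (E : Type u) [Category.{v} E] where
  chosenPullbacks : ChosenPullbacks E
  exponentiable : ∀ {I J : E} (f : I ⟶ J), ExponentiableMorphism f
  one : E
  isTerminalOne : IsTerminal one

attribute [reducible, instance] LocallyCartesianClosed.chosenPullbacks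
  LocallyCartesianClosed.exponentiable

/-- A polynomial `I ⟵ B ⟶ A ⟶ J` from `I` to `J`. -/
structure Poly {E : Type u} [Category.{v} E] (I J : E) where
  B : E
  A : E
  s : B ⟶ I
  f : B ⟶ A
  t : A ⟶ J

namespace Poly

section

variable {E : Type u} [Category.{v} E]

/-- The identity polynomial `i_I`. -/
def identity (I : E) : Poly I I where
  B := I
  A := I
  s := 𝟙 I
  f := 𝟙 I
  t := 𝟙 I

/-- A morphism of polynomials from `F` to `G`. -/
structure Hom {I J : E} (F G : Poly I J) where
  D : E
  top : D ⟶ F.A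
  φ₀ : F.A ⟶ G.A
  φ₁ : D ⟶ G.B
  φ₂ : D ⟶ F.B
  isPullback : IsPullback top φ₁ φ₀ G.f
  comm_f : φ₂ ≫ F.f = top
  comm_s : φ₂ ≫ F.s = φ₁ ≫ G.s
  comm_t : φ₀ ≫ G.t = F.t

/-- A morphism of polynomials is cartesian when its component `φ₂` is invertible. -/
def Hom.IsCartesian {I J : E} {F G : Poly I J} (φ : Hom F G) : Prop :=
  IsIso φ.φ₂

end

variable {E : Type u} [Category.{v} E] [LocallyCartesianClosed E]

open LocallyCartesianClosed

/-- A morphism of `E`, regarded as a polynomial from `1` to `1`. -/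
def ofHom {B A : E} (f : B ⟶ A) : Poly (one : E) (one : E) where
  B := B
  A := A
  s := isTerminalOne.from B
  f := f
  t := isTerminalOne.from A

/-- The extension `Σ_t Π_f Δ_s` of a polynomial. -/
def extension {I J : E} (F : Poly I J) : Over I ⥤ Over J :=
  ChosenPullbacksAlong.pullback F.s ⋙ ExponentiableMorphism.pushforward F.f ⋙ Over.map F.t

/-- The polynomial endofunctor `P_f : E ⥤ E` of a morphism `f`: the extension of `f`, regarded
as a polynomial from `1` to `1`, along the canonical identification of `Over 1` with `E`. -/
def endofunctor {B A : E} (f : B ⟶ A) : E ⥤ E :=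
  (Over.equivalenceOfIsTerminal (isTerminalOne (E := E))).inverse ⋙ (ofHom f).extension ⋙
    (Over.equivalenceOfIsTerminal (isTerminalOne (E := E))).functor

section Composition

variable {I J K : E} (G : Poly J K) (F : Poly I J)

/-- The morphism `h`: the pullback of `t` along `u`, as an object over `D`. -/
def compH : Over G.B :=
  (ChosenPullbacksAlong.pullback G.s).obj (Over.mk F.t)

/-- The morphism from the domain of `h` to `A`. -/
def compToA : (compH G F).left ⟶ F.A :=
  ((ChosenPullbacksAlong.mapPullbackAdj G.s).counit.app (Over.mk F.t)).left

/-- The morphism `w = Π_g(h)`, as an object over `C`. -/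
def compW : Over G.A :=
  (ExponentiableMorphism.pushforward G.f).obj (compH G F)

/-- The pullback `Δ_g(w)` of `w` along `g`, as an object over `D`. -/
def compQObj : Over G.B :=
  (ChosenPullbacksAlong.pullback G.f).obj (compW G F)

/-- The morphism `q : Δ_g(w) ⟶ w`, the pullback of `g` along `w`. -/
def compQ : (compQObj G F).left ⟶ (compW G F).left :=
  ((ChosenPullbacksAlong.mapPullbackAdj G.f).counit.app (compW G F)).left

/-- The component `e` at `h` of the counit of `Δ_g ⊣ Π_g`. -/
def compE : (compQObj G F).left ⟶ (compH G F).left :=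
  ((ExponentiableMorphism.pullbackPushforwardAdj G.f).counit.app (compH G F)).left

/-- The object `N`: the pullback of `f` along the composite `Δ_g(w) ⟶ A`. -/
def compN : Over (compQObj G F).left :=
  (ChosenPullbacksAlong.pullback (compE G F ≫ compToA G F)).obj (Over.mk F.f)

/-- The projection `n : N ⟶ B`. -/
def compNToB : (compN G F).left ⟶ F.B :=
  ((ChosenPullbacksAlong.mapPullbackAdj (compE G F ≫ compToA G F)).counit.app
    (Over.mk F.f)).left

/-- The composite `G · F` of polynomials, `I ⟵ N ⟶ M ⟶ K`. -/
def comp : Poly I K where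
  B := (compN G F).left
  A := (compW G F).left
  s := compNToB G F ≫ F.s
  f := (compN G F).hom ≫ compQ G F
  t := (compW G F).hom ≫ G.t

end Composition

end Poly

/-! ### Presheaf categories are locally cartesian closed -/

section Presheaf

/-- In a category with chosen pullbacks, a morphism `f : J ⟶ I` is exponentiable when the slice
over `I` is cartesian closed. -/
theorem isLeftAdjoint_pullback {E : Type u} [Category.{v} E] [ChosenPullbacks E] {D : Type*}
    [Category* D] [CartesianMonoidalCategory D] [MonoidalClosed D] {I J : E}
    (e : Over I ≌ D) (f : J ⟶ I) : (ChosenPullbacksAlong.pullback f).IsLeftAdjoint := by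
  let : CartesianMonoidalCategory (Over I) := ChosenPullbacksAlong.cartesianMonoidalCategoryOver I
  let : BraidedCategory (Over I) := .ofCartesianMonoidalCategory
  let : MonoidalClosed (Over I) := cartesianClosedOfEquiv e.symm
  have : HasPullbacks (Over I) := inferInstance
  let : ChosenPullbacksAlong (curryRightUnitorHom (Over.mk f)) :=
    ChosenPullbacksAlong.ofHasPullbacksAlong _
  have : (toOver (Over.mk f)).IsLeftAdjoint := (Over.toOverSectionsAdj (Over.mk f)).isLeftAdjoint
  have : ((Over.mk f).iteratedSliceForward).IsLeftAdjoint :=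
    (Over.mk f).iteratedSliceEquiv.toAdjunction.isLeftAdjoint
  exact Functor.isLeftAdjoint_of_iso (toOverIteratedSliceForwardIsoPullback f)

/-- A category of presheaves of sets on a small category is locally cartesian closed. -/
theorem nonempty_locallyCartesianClosed_presheaf (C : Type u) [SmallCategory.{u} C] :
    Nonempty (LocallyCartesianClosed (Cᵒᵖ ⥤ Type u)) := by
  let cp : ChosenPullbacks (Cᵒᵖ ⥤ Type u) := fun f ↦ ChosenPullbacksAlong.ofHasPullbacksAlong f
  have h {I J : Cᵒᵖ ⥤ Type u} (f : J ⟶ I) : (ChosenPullbacksAlong.pullback f).IsLeftAdjoint :=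
    isLeftAdjoint_pullback (overEquivPresheafCostructuredArrow I) f
  exact ⟨{
    chosenPullbacks := cp
    exponentiable := fun f ↦
      { pushforward := (ChosenPullbacksAlong.pullback f).rightAdjoint
        pullbackPushforwardAdj := Adjunction.ofIsLeftAdjoint _ }
    one := ⊤_ _
    isTerminalOne := terminalIsTerminal }⟩

end Presheaf

/-! ### Natural models -/

/-- A natural model on the category `C`. -/
structure NaturalModel (C : Type u) [SmallCategory.{u} C] where
  empty : C
  isTerminalEmpty : IsTerminal empty
  Tm : Cᵒᵖ ⥤ Type u
  Ty : Cᵒᵖ ⥤ Type u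
  p : Tm ⟶ Ty
  /-- The extended context `Γ.A`. -/
  ext (Γ : C) (A : Ty.obj (op Γ)) : C
  /-- The projection `p_A : Γ.A ⟶ Γ`. -/
  disp {Γ : C} (A : Ty.obj (op Γ)) : ext Γ A ⟶ Γ
  /-- The generic term `q_A`. -/
  var {Γ : C} (A : Ty.obj (op Γ)) : Tm.obj (op (ext Γ A))
  isPullback {Γ : C} (A : Ty.obj (op Γ)) :
    IsPullback (yonedaEquiv.symm (var A)) (yoneda.map (disp A)) p (yonedaEquiv.symm A)

namespace NaturalModel

variable {C : Type u} [SmallCategory.{u} C] (M : NaturalModel C)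

/-- Types in context `Γ`. -/
abbrev TyIn (Γ : C) : Type u := M.Ty.obj (op Γ)

/-- Terms in context `Γ`. -/
abbrev TmIn (Γ : C) : Type u := M.Tm.obj (op Γ)

/-- The type of a term. -/
def typeOf {Γ : C} (a : M.TmIn Γ) : M.TyIn Γ := M.p.app (op Γ) a

variable {M}

/-- Substitution `A[σ]` in types. -/
def tySub {Δ Γ : C} (σ : Δ ⟶ Γ) (A : M.TyIn Γ) : M.TyIn Δ := M.Ty.map σ.op A

/-- Substitution `a[σ]` in terms. -/
def tmSub {Δ Γ : C} (σ : Δ ⟶ Γ) (a : M.TmIn Γ) : M.TmIn Δ := M.Tm.map σ.op a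

@[simp]
theorem tySub_id {Γ : C} (A : M.TyIn Γ) : tySub (𝟙 Γ) A = A := by
  simp [tySub]

theorem tySub_comp {Θ Δ Γ : C} (τ : Θ ⟶ Δ) (σ : Δ ⟶ Γ) (A : M.TyIn Γ) :
    tySub (τ ≫ σ) A = tySub τ (tySub σ A) := by
  simp [tySub]

theorem tmSub_comp {Θ Δ Γ : C} (τ : Θ ⟶ Δ) (σ : Δ ⟶ Γ) (a : M.TmIn Γ) :
    tmSub (τ ≫ σ) a = tmSub τ (tmSub σ a) := by
  simp [tmSub]

theorem typeOf_tmSub {Δ Γ : C} (σ : Δ ⟶ Γ) (a : M.TmIn Γ) :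
    M.typeOf (tmSub σ a) = tySub σ (M.typeOf a) :=
  NatTrans.naturality_apply M.p σ.op a

theorem typeOf_var {Γ : C} (A : M.TyIn Γ) : M.typeOf (M.var A) = tySub (M.disp A) A := by
  have h := congrArg yonedaEquiv (M.isPullback A).w
  rw [yonedaEquiv_comp, Equiv.apply_symm_apply, ← yonedaEquiv_naturality,
    Equiv.apply_symm_apply] at h
  exact h

/-- The substitution `⟨σ, a⟩ : Δ ⟶ Γ.A` given by `σ : Δ ⟶ Γ` and a term `a : A[σ]`. -/
noncomputable def pairSub {Δ Γ : C} (σ : Δ ⟶ Γ) (A : M.TyIn Γ) (a : M.TmIn Δ)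
    (ha : M.typeOf a = tySub σ A) : Δ ⟶ M.ext Γ A :=
  yonedaEquiv (F := yoneda.obj (M.ext Γ A))
    ((M.isPullback A).lift (yonedaEquiv.symm a) (yoneda.map σ) (by
      rw [yonedaEquiv_symm_naturality_right, yonedaEquiv_symm_naturality_left]
      exact congrArg _ ha))

theorem pairSub_disp {Δ Γ : C} (σ : Δ ⟶ Γ) (A : M.TyIn Γ) (a : M.TmIn Δ)
    (ha : M.typeOf a = tySub σ A) : pairSub σ A a ha ≫ M.disp A = σ := by
  apply yoneda.map_injective
  rw [Functor.map_comp, ← IsPullback.lift_snd (M.isPullback A) (yonedaEquiv.symm a) (yoneda.map σ)]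
  congr 1
  apply yonedaEquiv.injective
  rw [yonedaEquiv_yoneda_map]
  rfl

theorem tmSub_pairSub_var {Δ Γ : C} (σ : Δ ⟶ Γ) (A : M.TyIn Γ) (a : M.TmIn Δ)
    (ha : M.typeOf a = tySub σ A) : tmSub (pairSub σ A a ha) (M.var A) = a := by
  apply yonedaEquiv.symm.injective
  rw [tmSub, ← yonedaEquiv_symm_naturality_left,
    ← IsPullback.lift_fst (M.isPullback A) (yonedaEquiv.symm a) (yoneda.map σ)]
  congr 1
  apply yonedaEquiv.injective
  rw [yonedaEquiv_yoneda_map]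
  rfl

theorem sub_ext {Δ Γ : C} {A : M.TyIn Γ} {σ τ : Δ ⟶ M.ext Γ A}
    (h₁ : σ ≫ M.disp A = τ ≫ M.disp A) (h₂ : tmSub σ (M.var A) = tmSub τ (M.var A)) : σ = τ := by
  apply yoneda.map_injective
  apply (M.isPullback A).hom_ext
  · rw [yonedaEquiv_symm_naturality_left, yonedaEquiv_symm_naturality_left]
    exact congrArg _ h₂
  · rw [← Functor.map_comp, ← Functor.map_comp, h₁]

/-- The weakened substitution `σ.A : Δ.A[σ] ⟶ Γ.A`. -/
noncomputable def liftSub {Δ Γ : C} (σ : Δ ⟶ Γ) (A : M.TyIn Γ) : M.ext Δ (tySub σ A) ⟶ M.ext Γ A :=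
  pairSub (M.disp (tySub σ A) ≫ σ) A (M.var (tySub σ A)) (by rw [typeOf_var, tySub_comp])

/-- The substitution `⟨1, a⟩ : Γ ⟶ Γ.A` of a term `a : A` for the last variable. -/
noncomputable def instSub {Γ : C} (A : M.TyIn Γ) (a : M.TmIn Γ) (ha : M.typeOf a = A) : Γ ⟶ M.ext Γ A :=
  pairSub (𝟙 Γ) A a (by rw [tySub_id, ha])

theorem typeOf_tmSub_eq {Δ Γ : C} (σ : Δ ⟶ Γ) {A : M.TyIn Γ} {a : M.TmIn Γ}
    (ha : M.typeOf a = A) : M.typeOf (tmSub σ a) = tySub σ A := by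
  rw [typeOf_tmSub, ha]

theorem instSub_liftSub {Δ Γ : C} (σ : Δ ⟶ Γ) (A : M.TyIn Γ) (a : M.TmIn Γ)
    (ha : M.typeOf a = A) :
    instSub (tySub σ A) (tmSub σ a) (typeOf_tmSub_eq σ ha) ≫ liftSub σ A =
      σ ≫ instSub A a ha := by
  apply sub_ext
  · rw [Category.assoc, Category.assoc, liftSub, pairSub_disp, instSub, instSub, pairSub_disp,
      ← Category.assoc, pairSub_disp, Category.id_comp, Category.comp_id]
  · rw [tmSub_comp, tmSub_comp, liftSub, tmSub_pairSub_var, instSub, instSub, tmSub_pairSub_var,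
      tmSub_pairSub_var]

theorem instSub_var_liftSub {Γ : C} (A : M.TyIn Γ) :
    instSub (tySub (M.disp A) A) (M.var A) (typeOf_var A) ≫ liftSub (M.disp A) A =
      𝟙 (M.ext Γ A) := by
  apply sub_ext
  · rw [Category.assoc, liftSub, pairSub_disp, instSub, ← Category.assoc, pairSub_disp]
  · rw [tmSub_comp, liftSub, tmSub_pairSub_var, instSub, tmSub_pairSub_var]
    simp [tmSub]

theorem typeOf_tmSub_inst {Δ Γ : C} (σ : Δ ⟶ Γ) {A : M.TyIn Γ} {B : M.TyIn (M.ext Γ A)}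
    {a : M.TmIn Γ} (ha : M.typeOf a = A) {b : M.TmIn Γ}
    (hb : M.typeOf b = tySub (instSub A a ha) B) :
    M.typeOf (tmSub σ b) =
      tySub (instSub (tySub σ A) (tmSub σ a) (typeOf_tmSub_eq σ ha))
        (tySub (liftSub σ A) B) := by
  rw [← tySub_comp, instSub_liftSub, tySub_comp, typeOf_tmSub, hb]

variable (M)

/-- The rules for a unit type `1` with term `⋆`, stable under substitution. -/
structure UnitTypes where
  unit (Γ : C) : M.TyIn Γ
  unit_sub {Δ Γ : C} (σ : Δ ⟶ Γ) : tySub σ (unit Γ) = unit Δ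
  star (Γ : C) : M.TmIn Γ
  typeOf_star (Γ : C) : M.typeOf (star Γ) = unit Γ
  star_sub {Δ Γ : C} (σ : Δ ⟶ Γ) : tmSub σ (star Γ) = star Δ
  eta {Γ : C} (t : M.TmIn Γ) (ht : M.typeOf t = unit Γ) : t = star Γ

/-- The rules for dependent sum types: formation, pairing, projections, the computation rules for
the projections, surjective pairing, and stability of all operations under substitution. -/
structure SigmaTypes where
  sigma {Γ : C} (A : M.TyIn Γ) (B : M.TyIn (M.ext Γ A)) : M.TyIn Γ
  sigma_sub {Δ Γ : C} (σ : Δ ⟶ Γ) (A : M.TyIn Γ) (B : M.TyIn (M.ext Γ A)) :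
    tySub σ (sigma A B) = sigma (tySub σ A) (tySub (liftSub σ A) B)
  pair {Γ : C} (A : M.TyIn Γ) (B : M.TyIn (M.ext Γ A)) (a : M.TmIn Γ) (ha : M.typeOf a = A)
    (b : M.TmIn Γ) (hb : M.typeOf b = tySub (instSub A a ha) B) : M.TmIn Γ
  typeOf_pair {Γ : C} (A : M.TyIn Γ) (B : M.TyIn (M.ext Γ A)) (a : M.TmIn Γ)
    (ha : M.typeOf a = A) (b : M.TmIn Γ) (hb : M.typeOf b = tySub (instSub A a ha) B) :
    M.typeOf (pair A B a ha b hb) = sigma A B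
  pair_sub {Δ Γ : C} (σ : Δ ⟶ Γ) (A : M.TyIn Γ) (B : M.TyIn (M.ext Γ A)) (a : M.TmIn Γ)
    (ha : M.typeOf a = A) (b : M.TmIn Γ) (hb : M.typeOf b = tySub (instSub A a ha) B) :
    tmSub σ (pair A B a ha b hb) =
      pair (tySub σ A) (tySub (liftSub σ A) B) (tmSub σ a) (typeOf_tmSub_eq σ ha)
        (tmSub σ b) (typeOf_tmSub_inst σ ha hb)
  fst {Γ : C} (A : M.TyIn Γ) (B : M.TyIn (M.ext Γ A)) (c : M.TmIn Γ)
    (hc : M.typeOf c = sigma A B) : M.TmIn Γ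
  typeOf_fst {Γ : C} (A : M.TyIn Γ) (B : M.TyIn (M.ext Γ A)) (c : M.TmIn Γ)
    (hc : M.typeOf c = sigma A B) : M.typeOf (fst A B c hc) = A
  fst_sub {Δ Γ : C} (σ : Δ ⟶ Γ) (A : M.TyIn Γ) (B : M.TyIn (M.ext Γ A)) (c : M.TmIn Γ)
    (hc : M.typeOf c = sigma A B) :
    tmSub σ (fst A B c hc) =
      fst (tySub σ A) (tySub (liftSub σ A) B) (tmSub σ c)
        ((typeOf_tmSub_eq σ hc).trans (sigma_sub σ A B))
  snd {Γ : C} (A : M.TyIn Γ) (B : M.TyIn (M.ext Γ A)) (c : M.TmIn Γ)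
    (hc : M.typeOf c = sigma A B) : M.TmIn Γ
  typeOf_snd {Γ : C} (A : M.TyIn Γ) (B : M.TyIn (M.ext Γ A)) (c : M.TmIn Γ)
    (hc : M.typeOf c = sigma A B) :
    M.typeOf (snd A B c hc) = tySub (instSub A (fst A B c hc) (typeOf_fst A B c hc)) B
  snd_sub {Δ Γ : C} (σ : Δ ⟶ Γ) (A : M.TyIn Γ) (B : M.TyIn (M.ext Γ A)) (c : M.TmIn Γ)
    (hc : M.typeOf c = sigma A B) :
    tmSub σ (snd A B c hc) =
      snd (tySub σ A) (tySub (liftSub σ A) B) (tmSub σ c)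
        ((typeOf_tmSub_eq σ hc).trans (sigma_sub σ A B))
  fst_pair {Γ : C} (A : M.TyIn Γ) (B : M.TyIn (M.ext Γ A)) (a : M.TmIn Γ)
    (ha : M.typeOf a = A) (b : M.TmIn Γ) (hb : M.typeOf b = tySub (instSub A a ha) B) :
    fst A B (pair A B a ha b hb) (typeOf_pair A B a ha b hb) = a
  snd_pair {Γ : C} (A : M.TyIn Γ) (B : M.TyIn (M.ext Γ A)) (a : M.TmIn Γ)
    (ha : M.typeOf a = A) (b : M.TmIn Γ) (hb : M.typeOf b = tySub (instSub A a ha) B) :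
    snd A B (pair A B a ha b hb) (typeOf_pair A B a ha b hb) = b
  eta {Γ : C} (A : M.TyIn Γ) (B : M.TyIn (M.ext Γ A)) (c : M.TmIn Γ)
    (hc : M.typeOf c = sigma A B) :
    pair A B (fst A B c hc) (typeOf_fst A B c hc) (snd A B c hc) (typeOf_snd A B c hc) = c

/-- The rules for dependent product types: formation, abstraction, application, the `β` and `η`
rules, and stability of all operations under substitution. -/
structure PiTypes where
  pi {Γ : C} (A : M.TyIn Γ) (B : M.TyIn (M.ext Γ A)) : M.TyIn Γ
  pi_sub {Δ Γ : C} (σ : Δ ⟶ Γ) (A : M.TyIn Γ) (B : M.TyIn (M.ext Γ A)) :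
    tySub σ (pi A B) = pi (tySub σ A) (tySub (liftSub σ A) B)
  lam {Γ : C} (A : M.TyIn Γ) (B : M.TyIn (M.ext Γ A)) (b : M.TmIn (M.ext Γ A))
    (hb : M.typeOf b = B) : M.TmIn Γ
  typeOf_lam {Γ : C} (A : M.TyIn Γ) (B : M.TyIn (M.ext Γ A)) (b : M.TmIn (M.ext Γ A))
    (hb : M.typeOf b = B) : M.typeOf (lam A B b hb) = pi A B
  lam_sub {Δ Γ : C} (σ : Δ ⟶ Γ) (A : M.TyIn Γ) (B : M.TyIn (M.ext Γ A))
    (b : M.TmIn (M.ext Γ A)) (hb : M.typeOf b = B) :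
    tmSub σ (lam A B b hb) =
      lam (tySub σ A) (tySub (liftSub σ A) B) (tmSub (liftSub σ A) b)
        (typeOf_tmSub_eq (liftSub σ A) hb)
  app {Γ : C} (A : M.TyIn Γ) (B : M.TyIn (M.ext Γ A)) (f : M.TmIn Γ)
    (hf : M.typeOf f = pi A B) (a : M.TmIn Γ) (ha : M.typeOf a = A) : M.TmIn Γ
  typeOf_app {Γ : C} (A : M.TyIn Γ) (B : M.TyIn (M.ext Γ A)) (f : M.TmIn Γ)
    (hf : M.typeOf f = pi A B) (a : M.TmIn Γ) (ha : M.typeOf a = A) :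
    M.typeOf (app A B f hf a ha) = tySub (instSub A a ha) B
  app_sub {Δ Γ : C} (σ : Δ ⟶ Γ) (A : M.TyIn Γ) (B : M.TyIn (M.ext Γ A)) (f : M.TmIn Γ)
    (hf : M.typeOf f = pi A B) (a : M.TmIn Γ) (ha : M.typeOf a = A) :
    tmSub σ (app A B f hf a ha) =
      app (tySub σ A) (tySub (liftSub σ A) B)
        (tmSub σ f) ((typeOf_tmSub_eq σ hf).trans (pi_sub σ A B))
        (tmSub σ a) (typeOf_tmSub_eq σ ha)
  beta {Γ : C} (A : M.TyIn Γ) (B : M.TyIn (M.ext Γ A)) (b : M.TmIn (M.ext Γ A))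
    (hb : M.typeOf b = B) (a : M.TmIn Γ) (ha : M.typeOf a = A) :
    app A B (lam A B b hb) (typeOf_lam A B b hb) a ha = tmSub (instSub A a ha) b
  eta {Γ : C} (A : M.TyIn Γ) (B : M.TyIn (M.ext Γ A)) (f : M.TmIn Γ)
    (hf : M.typeOf f = pi A B) :
    lam A B
      (app (tySub (M.disp A) A) (tySub (liftSub (M.disp A) A) B)
        (tmSub (M.disp A) f) ((typeOf_tmSub_eq (M.disp A) hf).trans (pi_sub (M.disp A) A B))
        (M.var A) (typeOf_var A))
      (by rw [typeOf_app, ← tySub_comp, instSub_var_liftSub, tySub_id]) = f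

/-- The natural model supports unit types. -/
def SupportsUnitTypes : Prop := Nonempty M.UnitTypes

/-- The natural model supports dependent sum types. -/
def SupportsSigmaTypes : Prop := Nonempty M.SigmaTypes

/-- The natural model supports dependent product types. -/
def SupportsPiTypes : Prop := Nonempty M.PiTypes

end NaturalModel

end NaturalModels

/-!
All polynomials here have the terminal object at both ends, so a cartesian morphism of polynomials
`F ⇒ p` amounts to a pullback square from the middle map of `F` to `p`
(`Poly.exists_isCartesian_iff`), and pullback squares of presheaves are detected elementwise
(`isPullback_presheaf_iff`). It remains to compute the elements of the three polynomials and to read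
off what such a pullback square means.

For a presheaf `H` over the terms, an element of `Π_p(H)` over a type `A` in context `Γ` amounts to
an element of `H` in context `Γ.A` lying over the generic term of type `A`
(`existsUnique_depBody`). Indeed it is a map `(y Γ, A) ⟶ Π_p(H)`, whose transpose is a map
out of the pullback of `(y Γ, A)` along `p`; by the pullback square of the natural model that
pullback is represented by `Γ.A`. The correspondence evaluates an element, by the counit of
`Δ_p ⊣ Π_p`, at the generic term; evaluation at any other term is then obtained by substitution
(`map_instSub_depBody`). For `H = X × Tm` this gives:

* an element of `P_p(X)` is a type `A` together with an element of `X` in context `Γ.A`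
  (`existsUnique_polyBody`), naturally in `X`;
* an element of the domain of `p · p` over the element of `P_p(Ty)` given by `A` and `B` is a pair
  of terms `a : A` and `b : B[a]` (`existsUnique_compDom`).

Thus a map `P_p(Ty) ⟶ Ty` is a formation rule stable under substitution, and the top map of the
square is an introduction rule: `⋆` for the identity polynomial, pairing for `p · p`, abstraction
for `P_p(p)`. Commutativity of the square is the typing of the introduction rule. That the square is
a pullback says that the introduction rule is bijective onto the terms of the type formed: existence
of preimages gives the elimination rules and the `η` rules, uniqueness the computation rules.
-/

namespace NaturalModels

/-! ### Pullbacks of presheaves and cartesian morphisms -/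

/-- Pullback squares of presheaves are computed elementwise. -/
theorem isPullback_presheaf_iff {C : Type u} [SmallCategory.{u} C] {P X Y Z : Cᵒᵖ ⥤ Type u}
    {t : P ⟶ X} {l : P ⟶ Y} {r : X ⟶ Z} {b : Y ⟶ Z} :
    IsPullback t l r b ↔ t ≫ r = l ≫ b ∧ ∀ (Γ : C) (x : X.obj (op Γ)) (y : Y.obj (op Γ)),
      r.app (op Γ) x = b.app (op Γ) y →
        ∃! z : P.obj (op Γ), t.app (op Γ) z = x ∧ l.app (op Γ) z = y := by
  constructor
  · refine fun h ↦ ⟨h.w, fun Γ x y hxy ↦ ?_⟩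
    obtain ⟨z, hz⟩ := Types.exists_of_isPullback (h.app (op Γ)) x y hxy
    exact ⟨z, hz, fun z' hz' ↦ Types.ext_of_isPullback (h.app (op Γ))
      (hz'.1.trans hz.1.symm) (hz'.2.trans hz.2.symm)⟩
  · rintro ⟨w, h⟩
    refine IsPullback.of_forall_isPullback_app fun Γ ↦ (Types.isPullback_iff _ _ _ _).2
      ⟨NatTrans.congr_app w Γ, fun z z' hz ↦ ?_, fun x y hxy ↦ (h Γ.unop x y hxy).exists⟩
    refine (h Γ.unop (t.app Γ z') (l.app Γ z') ?_).unique hz ⟨rfl, rfl⟩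
    exact ConcreteCategory.congr_hom (NatTrans.congr_app w Γ) z'

namespace Poly

variable {E : Type u} [Category.{v} E] [LocallyCartesianClosed E]

open LocallyCartesianClosed

/-- As maps to the terminal object are unique, a cartesian morphism to a polynomial `g` consists
only of a pullback square. -/
theorem exists_isCartesian_iff (F : Poly (one : E) one) {D A : E} (g : D ⟶ A) :
    (∃ φ : Hom F (ofHom g), φ.IsCartesian) ↔
      ∃ (φ₀ : F.A ⟶ A) (ψ : F.B ⟶ D), IsPullback F.f ψ φ₀ g := by
  constructor
  · rintro ⟨φ, hφ⟩
    have : IsIso φ.φ₂ := hφ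
    refine ⟨φ.φ₀, inv φ.φ₂ ≫ φ.φ₁, φ.isPullback.of_iso (asIso φ.φ₂) (Iso.refl _) (Iso.refl _)
      (Iso.refl _) ?_ ?_ ?_ ?_⟩
    · simpa using φ.comm_f.symm
    · exact (Category.comp_id _).trans (IsIso.hom_inv_id_assoc _ _).symm
    · exact (Category.comp_id _).trans (Category.id_comp _).symm
    · exact (Category.comp_id _).trans (Category.id_comp _).symm
  · rintro ⟨φ₀, ψ, h⟩
    exact ⟨{
      D := F.B
      top := F.f
      φ₀ := φ₀
      φ₁ := ψ
      φ₂ := 𝟙 _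
      isPullback := h
      comm_f := Category.id_comp _
      comm_s := isTerminalOne.hom_ext _ _
      comm_t := isTerminalOne.hom_ext _ _ }, inferInstanceAs (IsIso (𝟙 _))⟩

end Poly

namespace NaturalModel

open LocallyCartesianClosed

variable {C : Type u} [SmallCategory.{u} C] {M : NaturalModel C}

/-! ### Substitution calculus -/

theorem pairSub_disp_var {Γ : C} (A : M.TyIn Γ) :
    pairSub (M.disp A) A (M.var A) (typeOf_var A) = 𝟙 (M.ext Γ A) := by
  apply sub_ext
  · rw [pairSub_disp, Category.id_comp]
  · rw [tmSub_pairSub_var]; simp [tmSub]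

theorem map_comp_apply {X : Cᵒᵖ ⥤ Type u} {Θ Δ Γ : C} (τ : Θ ⟶ Δ) (σ : Δ ⟶ Γ)
    (x : X.obj (op Γ)) : X.map (τ ≫ σ).op x = X.map τ.op (X.map σ.op x) := by
  simp

/-- The type of an element is compatible with substitution, for a presheaf over the types. -/
theorem hom_map {W : Over M.Ty} {Δ Γ : C} (σ : Δ ⟶ Γ) {w : W.left.obj (op Γ)} {A : M.TyIn Γ}
    (h : W.hom.app (op Γ) w = A) :
    W.hom.app (op Δ) (W.left.map σ.op w) = tySub σ A := by
  rw [NatTrans.naturality_apply, h]; rfl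

theorem hom_left_app {W W' : Over M.Ty} (k : W ⟶ W') {Γ : C} (w : W.left.obj (op Γ)) :
    W'.hom.app (op Γ) (k.left.app (op Γ) w) = W.hom.app (op Γ) w :=
  ConcreteCategory.congr_hom (NatTrans.congr_app (Over.w k) (op Γ)) w

/-! ### Dependent products of presheaves along `p` -/

section DependentProduct

variable [LocallyCartesianClosed (Cᵒᵖ ⥤ Type u)]

/-- The pullback along `p` of a presheaf `W` over the types, as a pullback square: its elements are
the pairs of an element `w` of `W` and a term of the type of `w`. -/
theorem isPullback_pullback_p (W : Over M.Ty) :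
    IsPullback ((ChosenPullbacksAlong.mapPullbackAdj M.p).counit.app W).left
      ((ChosenPullbacksAlong.pullback M.p).obj W).hom W.hom M.p :=
  ChosenPullbacksAlong.isPullback W.hom M.p

theorem existsUnique_pullback_p {W : Over M.Ty} {Γ : C} (w : W.left.obj (op Γ)) (a : M.TmIn Γ)
    (h : W.hom.app (op Γ) w = M.typeOf a) :
    ∃! z : ((ChosenPullbacksAlong.pullback M.p).obj W).left.obj (op Γ),
      ((ChosenPullbacksAlong.mapPullbackAdj M.p).counit.app W).left.app (op Γ) z = w ∧
        ((ChosenPullbacksAlong.pullback M.p).obj W).hom.app (op Γ) z = a :=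
  (isPullback_presheaf_iff.1 (isPullback_pullback_p W)).2 Γ w a h

/-- The pair `(w, a)` as an element of the pullback along `p`. -/
noncomputable def pullbackPair {W : Over M.Ty} {Γ : C} (w : W.left.obj (op Γ)) (a : M.TmIn Γ)
    (h : W.hom.app (op Γ) w = M.typeOf a) :
    ((ChosenPullbacksAlong.pullback M.p).obj W).left.obj (op Γ) :=
  (existsUnique_pullback_p w a h).choose

theorem counit_pullbackPair {W : Over M.Ty} {Γ : C} (w : W.left.obj (op Γ)) (a : M.TmIn Γ)
    (h : W.hom.app (op Γ) w = M.typeOf a) :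
    ((ChosenPullbacksAlong.mapPullbackAdj M.p).counit.app W).left.app (op Γ)
      (pullbackPair w a h) = w :=
  (existsUnique_pullback_p w a h).choose_spec.1.1

theorem hom_pullbackPair {W : Over M.Ty} {Γ : C} (w : W.left.obj (op Γ)) (a : M.TmIn Γ)
    (h : W.hom.app (op Γ) w = M.typeOf a) :
    ((ChosenPullbacksAlong.pullback M.p).obj W).hom.app (op Γ) (pullbackPair w a h) = a :=
  (existsUnique_pullback_p w a h).choose_spec.1.2

theorem eq_pullbackPair {W : Over M.Ty} {Γ : C} {w : W.left.obj (op Γ)} {a : M.TmIn Γ}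
    (h : W.hom.app (op Γ) w = M.typeOf a)
    {z : ((ChosenPullbacksAlong.pullback M.p).obj W).left.obj (op Γ)}
    (h₁ : ((ChosenPullbacksAlong.mapPullbackAdj M.p).counit.app W).left.app (op Γ) z = w)
    (h₂ : ((ChosenPullbacksAlong.pullback M.p).obj W).hom.app (op Γ) z = a) :
    z = pullbackPair w a h :=
  (existsUnique_pullback_p w a h).unique ⟨h₁, h₂⟩
    ⟨counit_pullbackPair w a h, hom_pullbackPair w a h⟩

theorem map_pullbackPair {W : Over M.Ty} {Δ Γ : C} (σ : Δ ⟶ Γ) (w : W.left.obj (op Γ))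
    (a : M.TmIn Γ) (h : W.hom.app (op Γ) w = M.typeOf a) :
    ((ChosenPullbacksAlong.pullback M.p).obj W).left.map σ.op (pullbackPair w a h) =
      pullbackPair (W.left.map σ.op w) (tmSub σ a)
        ((hom_map σ h).trans (typeOf_tmSub σ a).symm) := by
  apply eq_pullbackPair
  · exact (NatTrans.naturality_apply _ σ.op _).trans (by rw [counit_pullbackPair]; rfl)
  · exact (NatTrans.naturality_apply _ σ.op _).trans (by rw [hom_pullbackPair]; rfl)

theorem pullback_map_pullbackPair {W W' : Over M.Ty} (f : W ⟶ W') {Γ : C}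
    (w : W.left.obj (op Γ)) (a : M.TmIn Γ) (h : W.hom.app (op Γ) w = M.typeOf a)
    (h' : W'.hom.app (op Γ) (f.left.app (op Γ) w) = M.typeOf a) :
    ((ChosenPullbacksAlong.pullback M.p).map f).left.app (op Γ) (pullbackPair w a h) =
      pullbackPair (f.left.app (op Γ) w) a h' := by
  apply eq_pullbackPair
  · have := ConcreteCategory.congr_hom (NatTrans.congr_app (congrArg CommaMorphism.left
      ((ChosenPullbacksAlong.mapPullbackAdj M.p).counit.naturality f)) (op Γ))
      (pullbackPair w a h)
    refine this.trans ?_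
    exact congrArg (f.left.app (op Γ)) (counit_pullbackPair w a h)
  · have := ConcreteCategory.congr_hom (NatTrans.congr_app (Over.w
      ((ChosenPullbacksAlong.pullback M.p).map f)) (op Γ)) (pullbackPair w a h)
    exact this.trans (hom_pullbackPair w a h)

/-- The evaluation of an element `w` of the dependent product `Π_p(H)` at a term `a` of the type
of `w`, that is, the counit of `Δ_p ⊣ Π_p` at `(w, a)`. -/
noncomputable def depEval {H : Over M.Tm} {Γ : C}
    (w : ((ExponentiableMorphism.pushforward M.p).obj H).left.obj (op Γ)) (a : M.TmIn Γ)
    (h : ((ExponentiableMorphism.pushforward M.p).obj H).hom.app (op Γ) w = M.typeOf a) :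
    H.left.obj (op Γ) :=
  ((ExponentiableMorphism.pullbackPushforwardAdj M.p).counit.app H).left.app (op Γ)
    (pullbackPair w a h)

theorem hom_depEval {H : Over M.Tm} {Γ : C}
    (w : ((ExponentiableMorphism.pushforward M.p).obj H).left.obj (op Γ)) (a : M.TmIn Γ)
    (h : ((ExponentiableMorphism.pushforward M.p).obj H).hom.app (op Γ) w = M.typeOf a) :
    H.hom.app (op Γ) (depEval w a h) = a :=
  (ConcreteCategory.congr_hom (NatTrans.congr_app (Over.w
    ((ExponentiableMorphism.pullbackPushforwardAdj M.p).counit.app H)) (op Γ)) _).trans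
    (hom_pullbackPair w a h)

theorem map_depEval {H : Over M.Tm} {Δ Γ : C} (σ : Δ ⟶ Γ)
    (w : ((ExponentiableMorphism.pushforward M.p).obj H).left.obj (op Γ)) (a : M.TmIn Γ)
    (h : ((ExponentiableMorphism.pushforward M.p).obj H).hom.app (op Γ) w = M.typeOf a) :
    H.left.map σ.op (depEval w a h) =
      depEval (((ExponentiableMorphism.pushforward M.p).obj H).left.map σ.op w) (tmSub σ a)
        ((hom_map σ h).trans (typeOf_tmSub σ a).symm) := by
  rw [depEval, depEval, ← map_pullbackPair]
  exact (NatTrans.naturality_apply _ σ.op _).symm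

theorem pushforward_map_depEval {H H' : Over M.Tm} (f : H ⟶ H') {Γ : C}
    (w : ((ExponentiableMorphism.pushforward M.p).obj H).left.obj (op Γ)) (a : M.TmIn Γ)
    (h : ((ExponentiableMorphism.pushforward M.p).obj H).hom.app (op Γ) w = M.typeOf a)
    (h' : ((ExponentiableMorphism.pushforward M.p).obj H').hom.app (op Γ)
      (((ExponentiableMorphism.pushforward M.p).map f).left.app (op Γ) w) = M.typeOf a) :
    depEval (((ExponentiableMorphism.pushforward M.p).map f).left.app (op Γ) w) a h' =
      f.left.app (op Γ) (depEval w a h) := by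
  rw [depEval, ← pullback_map_pullbackPair _ w a h]
  exact ConcreteCategory.congr_hom (NatTrans.congr_app (congrArg CommaMorphism.left
    ((ExponentiableMorphism.pullbackPushforwardAdj M.p).counit.naturality f)) (op Γ)) _

/-- An element of the dependent product `Π_p(H)` over the type `A`, evaluated at the generic term
of type `A`. -/
noncomputable def depBody {H : Over M.Tm} {Γ : C}
    (w : ((ExponentiableMorphism.pushforward M.p).obj H).left.obj (op Γ)) (A : M.TyIn Γ)
    (h : ((ExponentiableMorphism.pushforward M.p).obj H).hom.app (op Γ) w = A) :
    H.left.obj (op (M.ext Γ A)) :=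
  depEval (((ExponentiableMorphism.pushforward M.p).obj H).left.map (M.disp A).op w) (M.var A)
    ((hom_map (M.disp A) h).trans (typeOf_var A).symm)

theorem depEval_congr {H : Over M.Tm} {Γ : C}
    {w w' : ((ExponentiableMorphism.pushforward M.p).obj H).left.obj (op Γ)} {a a' : M.TmIn Γ}
    (hw : w = w') (ha : a = a')
    (h : ((ExponentiableMorphism.pushforward M.p).obj H).hom.app (op Γ) w = M.typeOf a) :
    depEval w a h = depEval w' a' (by rw [← hw, ← ha, h]) := by
  subst hw ha; rfl

/-- Evaluation after a substitution is determined by the evaluation at the generic term. -/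
theorem map_pairSub_depBody {H : Over M.Tm} {Δ Γ : C} (σ : Δ ⟶ Γ)
    (w : ((ExponentiableMorphism.pushforward M.p).obj H).left.obj (op Γ)) (A : M.TyIn Γ)
    (h : ((ExponentiableMorphism.pushforward M.p).obj H).hom.app (op Γ) w = A) (a : M.TmIn Δ)
    (ha : M.typeOf a = tySub σ A) :
    H.left.map (pairSub σ A a ha).op (depBody w A h) =
      depEval (((ExponentiableMorphism.pushforward M.p).obj H).left.map σ.op w) a
        ((hom_map σ h).trans ha.symm) := by
  rw [depBody, map_depEval]
  apply depEval_congr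
  · rw [← map_comp_apply, pairSub_disp]
  · rw [tmSub_pairSub_var]

theorem map_instSub_depBody {H : Over M.Tm} {Γ : C}
    (w : ((ExponentiableMorphism.pushforward M.p).obj H).left.obj (op Γ)) (A : M.TyIn Γ)
    (h : ((ExponentiableMorphism.pushforward M.p).obj H).hom.app (op Γ) w = A) (a : M.TmIn Γ)
    (ha : M.typeOf a = A) :
    H.left.map (instSub A a ha).op (depBody w A h) = depEval w a (h.trans ha.symm) := by
  rw [instSub, map_pairSub_depBody]
  exact depEval_congr (by simp) rfl _

theorem map_liftSub_depBody {H : Over M.Tm} {Δ Γ : C} (σ : Δ ⟶ Γ)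
    (w : ((ExponentiableMorphism.pushforward M.p).obj H).left.obj (op Γ)) (A : M.TyIn Γ)
    (h : ((ExponentiableMorphism.pushforward M.p).obj H).hom.app (op Γ) w = A) :
    H.left.map (liftSub σ A).op (depBody w A h) =
      depBody (((ExponentiableMorphism.pushforward M.p).obj H).left.map σ.op w) (tySub σ A)
        (hom_map σ h) := by
  rw [liftSub, map_pairSub_depBody]
  exact depEval_congr (map_comp_apply _ _ _) rfl _

theorem hom_depBody {H : Over M.Tm} {Γ : C}
    (w : ((ExponentiableMorphism.pushforward M.p).obj H).left.obj (op Γ)) (A : M.TyIn Γ)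
    (h : ((ExponentiableMorphism.pushforward M.p).obj H).hom.app (op Γ) w = A) :
    H.hom.app (op (M.ext Γ A)) (depBody w A h) = M.var A :=
  hom_depEval _ _ _

theorem pushforward_map_depBody {H H' : Over M.Tm} (f : H ⟶ H') {Γ : C}
    (w : ((ExponentiableMorphism.pushforward M.p).obj H).left.obj (op Γ)) (A : M.TyIn Γ)
    (h : ((ExponentiableMorphism.pushforward M.p).obj H).hom.app (op Γ) w = A)
    (h' : ((ExponentiableMorphism.pushforward M.p).obj H').hom.app (op Γ)
      (((ExponentiableMorphism.pushforward M.p).map f).left.app (op Γ) w) = A) :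
    depBody (((ExponentiableMorphism.pushforward M.p).map f).left.app (op Γ) w) A h' =
      f.left.app (op (M.ext Γ A)) (depBody w A h) := by
  have hw := (hom_map (M.disp A) h).trans (typeOf_var A).symm
  rw [depBody, depBody,
    ← pushforward_map_depEval f _ (M.var A) hw ((hom_left_app _ _).trans hw)]
  exact depEval_congr (NatTrans.naturality_apply
    ((ExponentiableMorphism.pushforward M.p).map f).left (M.disp A).op w).symm rfl _

/-- The map `Δ_p(y Γ, A) ⟶ H` sending `(σ, a)` to `x[⟨σ, a⟩]`, for `x` over the generic term of
type `A`. -/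
noncomputable def pullbackYonedaDesc {H : Over M.Tm} {Γ : C} (A : M.TyIn Γ)
    (x : H.left.obj (op (M.ext Γ A))) (hx : H.hom.app (op (M.ext Γ A)) x = M.var A) :
    (ChosenPullbacksAlong.pullback M.p).obj (Over.mk (yonedaEquiv.symm A)) ⟶ H :=
  Over.homMk
    ((M.isPullback A).lift
      ((ChosenPullbacksAlong.pullback M.p).obj (Over.mk (yonedaEquiv.symm A))).hom
      ((ChosenPullbacksAlong.mapPullbackAdj M.p).counit.app (Over.mk (yonedaEquiv.symm A))).left
      (isPullback_pullback_p (Over.mk (yonedaEquiv.symm A))).w.symm ≫ yonedaEquiv.symm x)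
    (by
      have : yonedaEquiv.symm x ≫ H.hom = yonedaEquiv.symm (M.var A) := by
        rw [yonedaEquiv_symm_naturality_right, hx]
      rw [Category.assoc, this, IsPullback.lift_fst])

theorem pullbackYonedaDesc_apply {H : Over M.Tm} {Γ : C} (A : M.TyIn Γ)
    (x : H.left.obj (op (M.ext Γ A))) (hx : H.hom.app (op (M.ext Γ A)) x = M.var A) {Δ : C}
    (σ : Δ ⟶ Γ) (a : M.TmIn Δ) (ha : M.typeOf a = tySub σ A) :
    (pullbackYonedaDesc A x hx).left.app (op Δ)
      (pullbackPair (W := Over.mk (yonedaEquiv.symm A)) σ a ha.symm) =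
      H.left.map (pairSub σ A a ha).op x := by
  set z := pullbackPair (W := Over.mk (yonedaEquiv.symm A)) σ a ha.symm with hz
  set l := (M.isPullback A).lift
      ((ChosenPullbacksAlong.pullback M.p).obj (Over.mk (yonedaEquiv.symm A))).hom
      ((ChosenPullbacksAlong.mapPullbackAdj M.p).counit.app (Over.mk (yonedaEquiv.symm A))).left
      (isPullback_pullback_p (Over.mk (yonedaEquiv.symm A))).w.symm with hl
  have h₁ : tmSub (l.app (op Δ) z) (M.var A) = a :=
    (ConcreteCategory.congr_hom (NatTrans.congr_app ((M.isPullback A).lift_fst _ _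
      (isPullback_pullback_p (Over.mk (yonedaEquiv.symm A))).w.symm) (op Δ)) z).trans
      (hom_pullbackPair _ _ _)
  have h₂ : l.app (op Δ) z ≫ M.disp A = σ :=
    (ConcreteCategory.congr_hom (NatTrans.congr_app ((M.isPullback A).lift_snd _ _
      (isPullback_pullback_p (Over.mk (yonedaEquiv.symm A))).w.symm) (op Δ)) z).trans
      (counit_pullbackPair _ _ _)
  have h₃ : l.app (op Δ) z = pairSub σ A a ha := by
    apply sub_ext
    · rw [h₂, pairSub_disp]
    · rw [h₁, tmSub_pairSub_var]
  rw [← h₃]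
  rfl

/-- The transpose under `Δ_p ⊣ Π_p` of a map `k` into `Π_p(H)` evaluates the values of `k`. -/
theorem homEquiv_symm_pullbackPair {H : Over M.Tm} {W : Over M.Ty}
    (k : W ⟶ (ExponentiableMorphism.pushforward M.p).obj H) {Γ : C} (w : W.left.obj (op Γ))
    (a : M.TmIn Γ) (h : W.hom.app (op Γ) w = M.typeOf a)
    (h' : ((ExponentiableMorphism.pushforward M.p).obj H).hom.app (op Γ)
      (k.left.app (op Γ) w) = M.typeOf a) :
    (((ExponentiableMorphism.pullbackPushforwardAdj M.p).homEquiv W H).symm k).left.app (op Γ)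
      (pullbackPair w a h) = depEval (k.left.app (op Γ) w) a h' := by
  rw [Adjunction.homEquiv_counit, depEval, ← pullback_map_pullbackPair k w a h h']
  rfl

/-- An element of `Π_p(H)` over the type `A` amounts to an element of `H` over the generic term of
type `A`. -/
theorem existsUnique_depBody {H : Over M.Tm} {Γ : C} (A : M.TyIn Γ)
    (x : H.left.obj (op (M.ext Γ A))) (hx : H.hom.app (op (M.ext Γ A)) x = M.var A) :
    ∃! w : ((ExponentiableMorphism.pushforward M.p).obj H).left.obj (op Γ),
      ∃ h : ((ExponentiableMorphism.pushforward M.p).obj H).hom.app (op Γ) w = A,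
        depBody w A h = x := by
  set Y : Over M.Ty := Over.mk (yonedaEquiv.symm A) with hY
  refine existsUnique_of_exists_of_unique ?_ ?_
  · -- The element is the transpose of `pullbackYonedaDesc A x hx`, at the identity of `Γ`.
    set k := (ExponentiableMorphism.pullbackPushforwardAdj M.p).homEquiv Y H
      (pullbackYonedaDesc A x hx) with hk
    have hA : Y.hom.app (op Γ) (𝟙 Γ) = A := yonedaEquiv.apply_symm_apply A
    have hw := (hom_left_app k (𝟙 Γ)).trans hA
    have hd : (((ExponentiableMorphism.pushforward M.p).obj H).left.map (M.disp A).op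
        (k.left.app (op Γ) (𝟙 Γ))) = k.left.app (op (M.ext Γ A)) (M.disp A) :=
      (NatTrans.naturality_apply k.left (M.disp A).op (𝟙 Γ)).symm.trans
        (congrArg (k.left.app (op (M.ext Γ A))) (Category.comp_id (M.disp A)))
    refine ⟨k.left.app (op Γ) (𝟙 Γ), hw, ?_⟩
    rw [depBody, depEval_congr hd rfl,
      ← homEquiv_symm_pullbackPair k (M.disp A) (M.var A) (typeOf_var A).symm, hk,
      Equiv.symm_apply_apply, pullbackYonedaDesc_apply A x hx (M.disp A) (M.var A) (typeOf_var A),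
      pairSub_disp_var]
    simp
  · rintro w w' ⟨h, hw⟩ ⟨h', hw'⟩
    -- The maps from `y Γ` given by `w` and `w'` have the same transpose, as every element of the
    -- pullback of `y Γ` is a substitution paired with a term.
    let k : ∀ v : ((ExponentiableMorphism.pushforward M.p).obj H).left.obj (op Γ),
      ((ExponentiableMorphism.pushforward M.p).obj H).hom.app (op Γ) v = A →
        (Y ⟶ (ExponentiableMorphism.pushforward M.p).obj H) := fun v hv ↦
      Over.homMk (yonedaEquiv.symm v) (by rw [yonedaEquiv_symm_naturality_right, hv]; rfl)
    suffices hk : k w h = k w' h' from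
      yonedaEquiv.symm.injective (congrArg CommaMorphism.left hk)
    apply ((ExponentiableMorphism.pullbackPushforwardAdj M.p).homEquiv Y H).symm.injective
    ext ⟨Δ⟩ z
    set σ : Δ ⟶ Γ := ((ChosenPullbacksAlong.mapPullbackAdj M.p).counit.app Y).left.app (op Δ) z
    set a : M.TmIn Δ := ((ChosenPullbacksAlong.pullback M.p).obj Y).hom.app (op Δ) z
    have ha : Y.hom.app (op Δ) σ = M.typeOf a := ConcreteCategory.congr_hom
      (NatTrans.congr_app (isPullback_pullback_p Y).w (op Δ)) z
    have hz : z = pullbackPair (W := Y) σ a ha := eq_pullbackPair ha rfl rfl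
    have key (v) (hv : ((ExponentiableMorphism.pushforward M.p).obj H).hom.app (op Γ) v = A) :
        (((ExponentiableMorphism.pullbackPushforwardAdj M.p).homEquiv Y H).symm
          (k v hv)).left.app (op Δ) z = H.left.map (pairSub σ A a ha.symm).op (depBody v A hv) := by
      rw [hz, homEquiv_symm_pullbackPair (k v hv) σ a ha ((hom_map σ hv).trans ha)]
      exact (map_pairSub_depBody σ v A hv a ha.symm).symm
    exact (key w h).trans (((congrArg _ (hw.trans hw'.symm))).trans (key w' h').symm)

end DependentProduct

/-! ### The polynomial functor of `p` -/

section PolynomialFunctor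

variable [LocallyCartesianClosed (Cᵒᵖ ⥤ Type u)]

/-- The product of a presheaf with the presheaf of terms, as a presheaf over the terms. -/
def prodOver (M : NaturalModel C) (X : Cᵒᵖ ⥤ Type u) : Over M.Tm :=
  (ChosenPullbacksAlong.pullback (isTerminalOne.from M.Tm)).obj (Over.mk (isTerminalOne.from X))

/-- The projection from the product of `X` with the presheaf of terms to `X`. -/
def prodProj (M : NaturalModel C) (X : Cᵒᵖ ⥤ Type u) : (M.prodOver X).left ⟶ X :=
  ((ChosenPullbacksAlong.mapPullbackAdj (isTerminalOne.from M.Tm)).counit.app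
    (Over.mk (isTerminalOne.from X))).left

theorem existsUnique_prodOver {X : Cᵒᵖ ⥤ Type u} {Γ : C} (x : X.obj (op Γ)) (a : M.TmIn Γ) :
    ∃! y : (M.prodOver X).left.obj (op Γ),
      (M.prodProj X).app (op Γ) y = x ∧ (M.prodOver X).hom.app (op Γ) y = a := by
  refine (isPullback_presheaf_iff.1 (ChosenPullbacksAlong.isPullback (isTerminalOne.from X)
    (isTerminalOne.from M.Tm))).2 Γ x a ?_
  apply yonedaEquiv.symm.injective
  exact isTerminalOne.hom_ext _ _

/-- The functor `P_p`, with values in the presheaves over the types. -/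
def polyObj (M : NaturalModel C) (X : Cᵒᵖ ⥤ Type u) : Over M.Ty :=
  (ExponentiableMorphism.pushforward M.p).obj (M.prodOver X)

/-- The action of `P_p` on a map of presheaves, over the presheaf of types. -/
def polyMap (M : NaturalModel C) {X Y : Cᵒᵖ ⥤ Type u} (f : X ⟶ Y) : M.polyObj X ⟶ M.polyObj Y :=
  (ExponentiableMorphism.pushforward M.p).map
    ((ChosenPullbacksAlong.pullback (isTerminalOne.from M.Tm)).map
      (Over.homMk f (isTerminalOne.hom_ext _ _)))

variable {X Y : Cᵒᵖ ⥤ Type u}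

/-- The type of an element of `P_p(X)`. -/
def polyType {Γ : C} (w : (M.polyObj X).left.obj (op Γ)) : M.TyIn Γ :=
  (M.polyObj X).hom.app (op Γ) w

/-- The element of `X` in the context extended by the type `A`, given by an element of `P_p(X)`
of type `A`. -/
noncomputable def polyBody {Γ : C} (w : (M.polyObj X).left.obj (op Γ)) (A : M.TyIn Γ)
    (h : polyType w = A) : X.obj (op (M.ext Γ A)) :=
  (M.prodProj X).app (op (M.ext Γ A)) (depBody w A h)

theorem polyType_map {Δ Γ : C} (σ : Δ ⟶ Γ) {w : (M.polyObj X).left.obj (op Γ)} {A : M.TyIn Γ}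
    (h : polyType w = A) : polyType ((M.polyObj X).left.map σ.op w) = tySub σ A :=
  hom_map σ h

theorem map_liftSub_polyBody {Δ Γ : C} (σ : Δ ⟶ Γ) (w : (M.polyObj X).left.obj (op Γ))
    (A : M.TyIn Γ) (h : polyType w = A) :
    polyBody ((M.polyObj X).left.map σ.op w) (tySub σ A) (polyType_map σ h) =
      X.map (liftSub σ A).op (polyBody w A h) :=
  (congrArg ((M.prodProj X).app _) (map_liftSub_depBody σ w A h).symm).trans
    (NatTrans.naturality_apply (M.prodProj X) (liftSub σ A).op _)

/-- Instantiating the body of an element at a term is evaluation, by the counit, at that term. -/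
theorem map_instSub_polyBody {Γ : C} (w : (M.polyObj X).left.obj (op Γ))
    (A : M.TyIn Γ) (h : polyType w = A) (a : M.TmIn Γ) (ha : M.typeOf a = A) :
    X.map (instSub A a ha).op (polyBody w A h) =
      (M.prodProj X).app (op Γ) (depEval w a (h.trans ha.symm)) :=
  (NatTrans.naturality_apply (M.prodProj X) (instSub A a ha).op _).symm.trans
    (congrArg ((M.prodProj X).app _) (map_instSub_depBody w A h a ha))

/-- An element of `P_p(X)` in context `Γ` amounts to a type `A` in context `Γ` and an element of
`X` in context `Γ.A`. -/
theorem existsUnique_polyBody {Γ : C} (A : M.TyIn Γ) (x : X.obj (op (M.ext Γ A))) :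
    ∃! w : (M.polyObj X).left.obj (op Γ), ∃ h : polyType w = A, polyBody w A h = x := by
  obtain ⟨y, ⟨hy₁, hy₂⟩, hy⟩ := existsUnique_prodOver x (M.var A)
  obtain ⟨w, ⟨h, hw⟩, hw'⟩ := existsUnique_depBody A y hy₂
  exact ⟨w, ⟨h, (congrArg _ hw).trans hy₁⟩,
    fun v ⟨hv, hv'⟩ ↦ hw' v ⟨hv, hy _ ⟨hv', hom_depBody v A hv⟩⟩⟩

/-- The element of `P_p(X)` given by a type `A` and an element of `X` in context `Γ.A`. -/
noncomputable def polyMk {Γ : C} (A : M.TyIn Γ) (x : X.obj (op (M.ext Γ A))) :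
    (M.polyObj X).left.obj (op Γ) :=
  (existsUnique_polyBody A x).choose

theorem polyType_polyMk {Γ : C} (A : M.TyIn Γ) (x : X.obj (op (M.ext Γ A))) :
    polyType (polyMk A x) = A :=
  (existsUnique_polyBody A x).choose_spec.1.choose

theorem polyBody_polyMk {Γ : C} (A : M.TyIn Γ) (x : X.obj (op (M.ext Γ A))) :
    polyBody (polyMk A x) A (polyType_polyMk A x) = x :=
  (existsUnique_polyBody A x).choose_spec.1.choose_spec

theorem eq_polyMk {Γ : C} {w : (M.polyObj X).left.obj (op Γ)} {A : M.TyIn Γ}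
    {x : X.obj (op (M.ext Γ A))} (h : polyType w = A) (hx : polyBody w A h = x) :
    w = polyMk A x :=
  (existsUnique_polyBody A x).unique ⟨h, hx⟩ ⟨polyType_polyMk A x, polyBody_polyMk A x⟩

theorem polyMk_polyBody {Γ : C} (w : (M.polyObj X).left.obj (op Γ)) (A : M.TyIn Γ)
    (h : polyType w = A) : polyMk A (polyBody w A h) = w :=
  (eq_polyMk h rfl).symm

theorem map_polyMk {Δ Γ : C} (σ : Δ ⟶ Γ) (A : M.TyIn Γ) (x : X.obj (op (M.ext Γ A))) :
    (M.polyObj X).left.map σ.op (polyMk A x) = polyMk (tySub σ A) (X.map (liftSub σ A).op x) :=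
  eq_polyMk (polyType_map σ (polyType_polyMk A x))
    ((map_liftSub_polyBody σ _ A (polyType_polyMk A x)).trans (by rw [polyBody_polyMk]))

theorem polyMk_injective {Γ : C} (A : M.TyIn Γ) {x y : X.obj (op (M.ext Γ A))}
    (h : polyMk A x = polyMk A y) : x = y := by
  rw [← polyBody_polyMk A x, ← polyBody_polyMk A y]
  congr 1

theorem exists_eq_polyMk {Γ : C} (w : (M.polyObj X).left.obj (op Γ)) :
    ∃ (A : M.TyIn Γ) (x : X.obj (op (M.ext Γ A))), w = polyMk A x :=
  ⟨polyType w, polyBody w _ rfl, (polyMk_polyBody w _ rfl).symm⟩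

theorem polyMap_polyMk (f : X ⟶ Y) {Γ : C} (A : M.TyIn Γ) (x : X.obj (op (M.ext Γ A))) :
    (M.polyMap f).left.app (op Γ) (polyMk A x) = polyMk A (f.app (op (M.ext Γ A)) x) := by
  have h : polyType ((M.polyMap f).left.app (op Γ) (polyMk A x)) = A :=
    (hom_left_app (M.polyMap f) _).trans (polyType_polyMk A x)
  refine eq_polyMk h ?_
  have h₁ := pushforward_map_depBody ((ChosenPullbacksAlong.pullback
    (isTerminalOne.from M.Tm)).map (Over.homMk (U := Over.mk (isTerminalOne.from X))
      (V := Over.mk (isTerminalOne.from Y)) f (isTerminalOne.hom_ext _ _)))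
    (polyMk A x) A (polyType_polyMk A x) h
  have h₂ := ConcreteCategory.congr_hom (NatTrans.congr_app (congrArg CommaMorphism.left
    ((ChosenPullbacksAlong.mapPullbackAdj (isTerminalOne.from M.Tm)).counit.naturality
      (Over.homMk (U := Over.mk (isTerminalOne.from X)) (V := Over.mk (isTerminalOne.from Y)) f
        (isTerminalOne.hom_ext _ _)))) (op (M.ext Γ A)))
    (depBody (polyMk A x) A (polyType_polyMk A x))
  exact (congrArg ((M.prodProj Y).app _) h₁).trans (h₂.trans
    (congrArg (f.app (op (M.ext Γ A))) (polyBody_polyMk A x)))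

/-- The map out of `P_p(X)` given by an operation on types `A` and elements of `X` in context
`Γ.A`, stable under substitution. -/
noncomputable def polyDesc (F : ∀ {Γ : C} (A : M.TyIn Γ), X.obj (op (M.ext Γ A)) → Y.obj (op Γ))
    (hF : ∀ {Δ Γ : C} (σ : Δ ⟶ Γ) (A : M.TyIn Γ) (x : X.obj (op (M.ext Γ A))),
      Y.map σ.op (F A x) = F (tySub σ A) (X.map (liftSub σ A).op x)) :
    (M.polyObj X).left ⟶ Y where
  app Γ := TypeCat.ofHom fun w ↦ F (Γ := Γ.unop) (polyType w) (polyBody w _ rfl)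
  naturality := by
    rintro ⟨Γ⟩ ⟨Δ⟩ ⟨σ : Δ ⟶ Γ⟩
    ext w
    have key (v : (M.polyObj X).left.obj (op Δ)) (A : M.TyIn Δ) (h : polyType v = A) :
        F (polyType v) (polyBody v _ rfl) = F A (polyBody v A h) := by
      subst h; rfl
    refine (key _ _ (polyType_map σ rfl)).trans ?_
    rw [map_liftSub_polyBody]
    exact (hF σ _ _).symm

theorem polyDesc_polyMk
    (F : ∀ {Γ : C} (A : M.TyIn Γ), X.obj (op (M.ext Γ A)) → Y.obj (op Γ))
    (hF : ∀ {Δ Γ : C} (σ : Δ ⟶ Γ) (A : M.TyIn Γ) (x : X.obj (op (M.ext Γ A))),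
      Y.map σ.op (F A x) = F (tySub σ A) (X.map (liftSub σ A).op x))
    {Γ : C} (A : M.TyIn Γ) (x : X.obj (op (M.ext Γ A))) :
    (polyDesc F hF).app (op Γ) (polyMk A x) = F A x := by
  have key (v : (M.polyObj X).left.obj (op Γ)) (h : polyType v = A) :
      F (polyType v) (polyBody v _ rfl) = F A (polyBody v A h) := by
    subst h; rfl
  exact (key _ (polyType_polyMk A x)).trans (by rw [polyBody_polyMk])

end PolynomialFunctor

/-! ### Unit types -/

/-- The terminal presheaf has one element in each context, so a map out of it is a constant stable
under substitution; the pullback property says that `⋆` is the only term of the unit type. -/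
theorem supportsUnitTypes_iff [LocallyCartesianClosed (Cᵒᵖ ⥤ Type u)] (M : NaturalModel C) :
    M.SupportsUnitTypes ↔
    ∃ (φ : (one : Cᵒᵖ ⥤ Type u) ⟶ M.Ty) (ψ : one ⟶ M.Tm), IsPullback (𝟙 one) ψ φ M.p := by
  have hone (Γ : C) : Nonempty ((one : Cᵒᵖ ⥤ Type u).obj (op Γ)) :=
    ⟨yonedaEquiv (isTerminalOne.from (yoneda.obj Γ))⟩
  have hsub {Γ : C} (x y : (one : Cᵒᵖ ⥤ Type u).obj (op Γ)) : x = y :=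
    yonedaEquiv.symm.injective (isTerminalOne.hom_ext _ _)
  constructor
  · rintro ⟨S⟩
    refine ⟨{ app := fun Γ ↦ TypeCat.ofHom fun _ ↦ S.unit Γ.unop, naturality := ?_ },
      { app := fun Γ ↦ TypeCat.ofHom fun _ ↦ S.star Γ.unop, naturality := ?_ },
      isPullback_presheaf_iff.2 ⟨?_, ?_⟩⟩
    · intro Γ Δ σ
      ext x
      exact (S.unit_sub σ.unop).symm
    · intro Γ Δ σ
      ext x
      exact (S.star_sub σ.unop).symm
    · ext Γ x
      exact (S.typeOf_star Γ.unop).symm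
    · intro Γ x t ht
      exact ⟨x, ⟨rfl, (S.eta t ht.symm).symm⟩, fun y _ ↦ hsub y x⟩
  · rintro ⟨φ, ψ, h⟩
    obtain ⟨w, h⟩ := isPullback_presheaf_iff.1 h
    exact ⟨{
      unit := fun Γ ↦ φ.app (op Γ) (hone Γ).some
      unit_sub := fun {Δ Γ} σ ↦ (NatTrans.naturality_apply φ σ.op _).symm.trans
        (congrArg (φ.app (op Δ)) (hsub _ _))
      star := fun Γ ↦ ψ.app (op Γ) (hone Γ).some
      typeOf_star := fun Γ ↦ (ConcreteCategory.congr_hom (NatTrans.congr_app w (op Γ)) _).symm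
      star_sub := fun {Δ Γ} σ ↦ (NatTrans.naturality_apply ψ σ.op _).symm.trans
        (congrArg (ψ.app (op Δ)) (hsub _ _))
      eta := fun {Γ} t ht ↦ by
        obtain ⟨z, ⟨-, hz⟩, -⟩ := h Γ (hone Γ).some t ht.symm
        exact hz.symm.trans (congrArg (ψ.app (op Γ)) (hsub _ _)) }⟩

/-! ### Dependent product types -/

namespace PiTypes

variable (S : M.PiTypes)

/-- The term in context `Γ.A` obtained by applying a weakened term `f : Π(A, B)` to the last
variable. -/
noncomputable def appVar {Γ : C} (A : M.TyIn Γ) (B : M.TyIn (M.ext Γ A)) (f : M.TmIn Γ)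
    (hf : M.typeOf f = S.pi A B) : M.TmIn (M.ext Γ A) :=
  S.app (tySub (M.disp A) A) (tySub (liftSub (M.disp A) A) B)
    (tmSub (M.disp A) f) ((typeOf_tmSub_eq (M.disp A) hf).trans (S.pi_sub (M.disp A) A B))
    (M.var A) (typeOf_var A)

theorem typeOf_appVar {Γ : C} (A : M.TyIn Γ) (B : M.TyIn (M.ext Γ A)) (f : M.TmIn Γ)
    (hf : M.typeOf f = S.pi A B) : M.typeOf (S.appVar A B f hf) = B := by
  rw [appVar, S.typeOf_app, ← tySub_comp, instSub_var_liftSub, tySub_id]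

/-- The `β` rule, applied to the generic term: abstraction is injective. -/
theorem appVar_lam {Γ : C} (A : M.TyIn Γ) (B : M.TyIn (M.ext Γ A)) (b : M.TmIn (M.ext Γ A))
    (hb : M.typeOf b = B) :
    S.appVar A B (S.lam A B b hb) (S.typeOf_lam A B b hb) = b := by
  have key {Γ : C} (A : M.TyIn Γ) (B : M.TyIn (M.ext Γ A)) (f f' : M.TmIn Γ) (hff : f = f')
      (hf : M.typeOf f = S.pi A B) (a : M.TmIn Γ) (ha : M.typeOf a = A) :
      S.app A B f hf a ha = S.app A B f' (hff ▸ hf) a ha := by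
    subst hff; rfl
  rw [appVar, key _ _ _ _ (S.lam_sub (M.disp A) A B b hb), S.beta, ← tmSub_comp,
    instSub_var_liftSub]
  simp [tmSub]

theorem lam_typeOf {Γ : C} (A : M.TyIn Γ) (B : M.TyIn (M.ext Γ A)) (b : M.TmIn (M.ext Γ A))
    (h : M.typeOf b = B) : S.lam A (M.typeOf b) b rfl = S.lam A B b h := by
  subst h; rfl

theorem lam_typeOf_sub {Δ Γ : C} (σ : Δ ⟶ Γ) (A : M.TyIn Γ) (b : M.TmIn (M.ext Γ A)) :
    tmSub σ (S.lam A (M.typeOf b) b rfl) =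
      S.lam (tySub σ A) (M.typeOf (tmSub (liftSub σ A) b)) (tmSub (liftSub σ A) b) rfl :=
  (S.lam_sub σ A _ b rfl).trans (S.lam_typeOf _ _ _ _).symm

variable [LocallyCartesianClosed (Cᵒᵖ ⥤ Type u)]

/-- The formation rule as a map `P_p(Ty) ⟶ Ty`. -/
noncomputable def piMap : (M.polyObj M.Ty).left ⟶ M.Ty :=
  polyDesc S.pi S.pi_sub

/-- The abstraction rule as a map `P_p(Tm) ⟶ Tm`. -/
noncomputable def lamMap : (M.polyObj M.Tm).left ⟶ M.Tm :=
  polyDesc (fun A b ↦ S.lam A (M.typeOf b) b rfl) S.lam_typeOf_sub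

theorem piMap_polyMk {Γ : C} (A : M.TyIn Γ) (B : M.TyIn (M.ext Γ A)) :
    S.piMap.app (op Γ) (polyMk A B) = S.pi A B :=
  polyDesc_polyMk _ _ _ _

theorem lamMap_polyMk {Γ : C} (A : M.TyIn Γ) (B : M.TyIn (M.ext Γ A)) (b : M.TmIn (M.ext Γ A))
    (h : M.typeOf b = B) : S.lamMap.app (op Γ) (polyMk A b) = S.lam A B b h := by
  subst h; exact polyDesc_polyMk _ S.lam_typeOf_sub A b

/-- Dependent product types make the square of `P_p(p)`, `p`, formation and abstraction a
pullback: the unique preimage of a term `f : Π(A, B)` is `f` applied to the last variable. -/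
theorem isPullback : IsPullback (M.polyMap M.p).left S.lamMap S.piMap M.p := by
  refine isPullback_presheaf_iff.2 ⟨?_, fun Γ w f hf ↦ ?_⟩
  · ext ⟨Γ⟩ w
    obtain ⟨A, b, rfl⟩ := exists_eq_polyMk w
    refine (congrArg (S.piMap.app (op Γ)) (polyMap_polyMk M.p A b)).trans ?_
    refine (S.piMap_polyMk A _).trans ?_
    refine Eq.trans ?_ (congrArg (M.p.app (op Γ)) (S.lamMap_polyMk A _ b rfl)).symm
    exact (S.typeOf_lam A _ b rfl).symm
  · obtain ⟨A, B, rfl⟩ := exists_eq_polyMk w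
    have hf : M.typeOf f = S.pi A B := hf.symm.trans (S.piMap_polyMk A B)
    refine ⟨polyMk A (S.appVar A B f hf), ⟨?_, ?_⟩, ?_⟩
    · exact (polyMap_polyMk M.p A _).trans (congrArg (polyMk A) (S.typeOf_appVar A B f hf))
    · exact (S.lamMap_polyMk A B _ (S.typeOf_appVar A B f hf)).trans (S.eta A B f hf)
    · rintro v ⟨hv₁, hv₂⟩
      have hA : polyType v = A := by
        rw [← polyType_polyMk A B, ← hv₁]
        exact (hom_left_app (M.polyMap M.p) v).symm
      have hv : v = polyMk A (polyBody v A hA) := (polyMk_polyBody v A hA).symm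
      set b : M.TmIn (M.ext Γ A) := polyBody v A hA
      have hb : M.typeOf b = B := polyMk_injective A <|
        (polyMap_polyMk M.p A b).symm.trans ((congrArg _ hv.symm).trans hv₁)
      have hf' : S.lam A B b hb = f :=
        (S.lamMap_polyMk A B b hb).symm.trans ((congrArg _ hv.symm).trans hv₂)
      rw [hv]
      congr 1
      subst hf'
      exact (S.appVar_lam A B b hb).symm

end PiTypes

section PiTypesOfIsPullback

variable [LocallyCartesianClosed (Cᵒᵖ ⥤ Type u)] {π : (M.polyObj M.Ty).left ⟶ M.Ty}
  {l : (M.polyObj M.Tm).left ⟶ M.Tm}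

theorem typeOf_of_isPullback (h : IsPullback (M.polyMap M.p).left l π M.p) {Γ : C} (A : M.TyIn Γ)
    (b : M.TmIn (M.ext Γ A)) :
    M.typeOf (l.app (op Γ) (polyMk A b)) = π.app (op Γ) (polyMk A (M.typeOf b)) :=
  (ConcreteCategory.congr_hom (NatTrans.congr_app h.w (op Γ)) (polyMk A b)).symm.trans
    (congrArg (π.app (op Γ)) (polyMap_polyMk M.p A b))

theorem existsUnique_unlam (h : IsPullback (M.polyMap M.p).left l π M.p) {Γ : C} (A : M.TyIn Γ)
    (B : M.TyIn (M.ext Γ A)) (f : M.TmIn Γ) (hf : M.typeOf f = π.app (op Γ) (polyMk A B)) :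
    ∃! b : M.TmIn (M.ext Γ A), M.typeOf b = B ∧ l.app (op Γ) (polyMk A b) = f := by
  obtain ⟨w, ⟨hw₁, hw₂⟩, hw⟩ := (isPullback_presheaf_iff.1 h).2 Γ (polyMk A B) f hf.symm
  have hA : polyType w = A := by
    rw [← polyType_polyMk A B, ← hw₁]
    exact (hom_left_app (M.polyMap M.p) w).symm
  obtain ⟨b, rfl⟩ : ∃ b, w = polyMk A b := ⟨_, (polyMk_polyBody w A hA).symm⟩
  refine ⟨b, ⟨polyMk_injective A ((polyMap_polyMk M.p A b).symm.trans hw₁), hw₂⟩, ?_⟩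
  rintro b' ⟨hb', hf'⟩
  exact polyMk_injective A
    (hw _ ⟨(polyMap_polyMk M.p A b').trans (congrArg (polyMk A) hb'), hf'⟩)

/-- The inverse of abstraction: the unique term `b : B` with `λ(b) = f`. -/
noncomputable def unlam (h : IsPullback (M.polyMap M.p).left l π M.p) {Γ : C} (A : M.TyIn Γ)
    (B : M.TyIn (M.ext Γ A)) (f : M.TmIn Γ) (hf : M.typeOf f = π.app (op Γ) (polyMk A B)) :
    M.TmIn (M.ext Γ A) :=
  (existsUnique_unlam h A B f hf).choose

theorem typeOf_unlam (h : IsPullback (M.polyMap M.p).left l π M.p) {Γ : C} (A : M.TyIn Γ)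
    (B : M.TyIn (M.ext Γ A)) (f : M.TmIn Γ) (hf : M.typeOf f = π.app (op Γ) (polyMk A B)) :
    M.typeOf (unlam h A B f hf) = B :=
  (existsUnique_unlam h A B f hf).choose_spec.1.1

theorem lam_unlam (h : IsPullback (M.polyMap M.p).left l π M.p) {Γ : C} (A : M.TyIn Γ)
    (B : M.TyIn (M.ext Γ A)) (f : M.TmIn Γ) (hf : M.typeOf f = π.app (op Γ) (polyMk A B)) :
    l.app (op Γ) (polyMk A (unlam h A B f hf)) = f :=
  (existsUnique_unlam h A B f hf).choose_spec.1.2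

theorem eq_unlam (h : IsPullback (M.polyMap M.p).left l π M.p) {Γ : C} {A : M.TyIn Γ}
    {B : M.TyIn (M.ext Γ A)} {f : M.TmIn Γ} (hf : M.typeOf f = π.app (op Γ) (polyMk A B))
    {b : M.TmIn (M.ext Γ A)} (hb : M.typeOf b = B) (hbf : l.app (op Γ) (polyMk A b) = f) :
    b = unlam h A B f hf :=
  (existsUnique_unlam h A B f hf).unique ⟨hb, hbf⟩ ⟨typeOf_unlam h A B f hf, lam_unlam h A B f hf⟩

theorem formation_sub (φ : (M.polyObj M.Ty).left ⟶ M.Ty) {Δ Γ : C} (σ : Δ ⟶ Γ) (A : M.TyIn Γ)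
    (B : M.TyIn (M.ext Γ A)) :
    tySub σ (φ.app (op Γ) (polyMk A B)) =
      φ.app (op Δ) (polyMk (tySub σ A) (tySub (liftSub σ A) B)) :=
  (NatTrans.naturality_apply φ σ.op _).symm.trans (congrArg (φ.app (op Δ)) (map_polyMk σ A B))

theorem abstraction_sub (l : (M.polyObj M.Tm).left ⟶ M.Tm) {Δ Γ : C} (σ : Δ ⟶ Γ) (A : M.TyIn Γ)
    (b : M.TmIn (M.ext Γ A)) :
    tmSub σ (l.app (op Γ) (polyMk A b)) =
      l.app (op Δ) (polyMk (tySub σ A) (tmSub (liftSub σ A) b)) :=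
  (NatTrans.naturality_apply l σ.op _).symm.trans (congrArg (l.app (op Δ)) (map_polyMk σ A b))

theorem tmSub_unlam (h : IsPullback (M.polyMap M.p).left l π M.p) {Δ Γ : C} (σ : Δ ⟶ Γ)
    (A : M.TyIn Γ) (B : M.TyIn (M.ext Γ A)) (f : M.TmIn Γ)
    (hf : M.typeOf f = π.app (op Γ) (polyMk A B)) :
    tmSub (liftSub σ A) (unlam h A B f hf) =
      unlam h (tySub σ A) (tySub (liftSub σ A) B) (tmSub σ f)
        ((typeOf_tmSub_eq σ hf).trans (formation_sub π σ A B)) := by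
  apply eq_unlam
  · rw [typeOf_tmSub, typeOf_unlam]
  · rw [← abstraction_sub, lam_unlam]

/-- The dependent product types determined by a pullback square: application is the inverse of
abstraction, followed by instantiation of the last variable. -/
noncomputable def PiTypes.ofIsPullback (h : IsPullback (M.polyMap M.p).left l π M.p) :
    M.PiTypes where
  pi {Γ} A B := π.app (op Γ) (polyMk A B)
  pi_sub := formation_sub π
  lam {Γ} A _ b _ := l.app (op Γ) (polyMk A b)
  typeOf_lam A B b hb := by rw [typeOf_of_isPullback h, hb]
  lam_sub σ A _ b _ := abstraction_sub l σ A b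
  app A B f hf a ha := tmSub (instSub A a ha) (unlam h A B f hf)
  typeOf_app A B f hf a ha := by rw [typeOf_tmSub, typeOf_unlam]
  app_sub σ A B f hf a ha := by
    rw [← tmSub_unlam h σ A B f hf, ← tmSub_comp, ← tmSub_comp, instSub_liftSub]
  beta A B b hb a ha := by
    rw [← eq_unlam h _ hb rfl]
  eta A B f hf := by
    rw [← tmSub_unlam h (M.disp A) A B f hf, ← tmSub_comp, instSub_var_liftSub]
    exact (congrArg (fun b ↦ l.app _ (polyMk A b)) (by simp [tmSub])).trans (lam_unlam h A B f hf)

theorem supportsPiTypes_iff (M : NaturalModel C) : M.SupportsPiTypes ↔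
    ∃ (π : (M.polyObj M.Ty).left ⟶ M.Ty) (l : (M.polyObj M.Tm).left ⟶ M.Tm),
      IsPullback (M.polyMap M.p).left l π M.p :=
  ⟨fun ⟨S⟩ ↦ ⟨S.piMap, S.lamMap, S.isPullback⟩, fun ⟨_, _, h⟩ ↦ ⟨PiTypes.ofIsPullback h⟩⟩

end PiTypesOfIsPullback

/-! ### The composite of `p` with itself -/

section Composite

variable [LocallyCartesianClosed (Cᵒᵖ ⥤ Type u)]

/-- The domain of the composite polynomial `p · p`. -/
def compDom (M : NaturalModel C) : Cᵒᵖ ⥤ Type u :=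
  ((Poly.ofHom M.p).comp (Poly.ofHom M.p)).B

/-- The middle map of the composite polynomial `p · p`. -/
def compMap (M : NaturalModel C) : M.compDom ⟶ (M.polyObj M.Ty).left :=
  ((Poly.ofHom M.p).comp (Poly.ofHom M.p)).f

/-- The map from the domain of `p · p` to the pullback of `P_p(Ty)` along `p`. -/
def compPair (M : NaturalModel C) :
    M.compDom ⟶ ((ChosenPullbacksAlong.pullback M.p).obj (M.polyObj M.Ty)).left :=
  (Poly.compN (Poly.ofHom M.p) (Poly.ofHom M.p)).hom

/-- The first of the two terms that an element of the domain of `p · p` consists of. -/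
def compFst (M : NaturalModel C) : M.compDom ⟶ M.Tm :=
  M.compPair ≫ ((ChosenPullbacksAlong.pullback M.p).obj (M.polyObj M.Ty)).hom

/-- The second of the two terms that an element of the domain of `p · p` consists of. -/
def compSnd (M : NaturalModel C) : M.compDom ⟶ M.Tm :=
  Poly.compNToB (Poly.ofHom M.p) (Poly.ofHom M.p)

theorem isPullback_compSnd (M : NaturalModel C) : IsPullback M.compSnd M.compPair M.p
    (((ExponentiableMorphism.pullbackPushforwardAdj M.p).counit.app (M.prodOver M.Ty)).left ≫
      M.prodProj M.Ty) :=
  ChosenPullbacksAlong.isPullback M.p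
    (((ExponentiableMorphism.pullbackPushforwardAdj M.p).counit.app (M.prodOver M.Ty)).left ≫
      M.prodProj M.Ty)

/-- The condition for the terms `a` and `b` to form an element of the domain of `p · p` over the
element of `P_p(Ty)` given by `A` and `B`. -/
theorem comp_condition {Γ : C} (A : M.TyIn Γ) (B : M.TyIn (M.ext Γ A)) (a : M.TmIn Γ)
    (ha : M.typeOf a = A) :
    (((ExponentiableMorphism.pullbackPushforwardAdj M.p).counit.app (M.prodOver M.Ty)).left ≫
      M.prodProj M.Ty).app (op Γ)
        (pullbackPair (polyMk A B) a ((polyType_polyMk A B).trans ha.symm)) =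
      tySub (instSub A a ha) B := by
  refine Eq.trans ?_
    ((map_instSub_polyBody (polyMk A B) A (polyType_polyMk A B) a ha).symm.trans ?_)
  · rfl
  · rw [polyBody_polyMk]; rfl

theorem typeOf_compFst {Γ : C} {A : M.TyIn Γ} {B : M.TyIn (M.ext Γ A)}
    {n : M.compDom.obj (op Γ)} (hn : M.compMap.app (op Γ) n = polyMk A B) :
    M.typeOf (M.compFst.app (op Γ) n) = A := by
  have h := ConcreteCategory.congr_hom (NatTrans.congr_app
    (isPullback_pullback_p (M.polyObj M.Ty)).w (op Γ)) (M.compPair.app (op Γ) n)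
  exact h.symm.trans ((congrArg polyType hn).trans (polyType_polyMk A B))

theorem typeOf_compSnd {Γ : C} {A : M.TyIn Γ} {B : M.TyIn (M.ext Γ A)}
    {n : M.compDom.obj (op Γ)} (hn : M.compMap.app (op Γ) n = polyMk A B) :
    M.typeOf (M.compSnd.app (op Γ) n) =
      tySub (instSub A (M.compFst.app (op Γ) n) (typeOf_compFst hn)) B := by
  have h := ConcreteCategory.congr_hom (NatTrans.congr_app M.isPullback_compSnd.w (op Γ)) n
  refine h.trans (Eq.trans ?_ (comp_condition A B _ (typeOf_compFst hn)))
  exact congrArg ((((ExponentiableMorphism.pullbackPushforwardAdj M.p).counit.app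
    (M.prodOver M.Ty)).left ≫ M.prodProj M.Ty).app (op Γ))
    (eq_pullbackPair ((polyType_polyMk A B).trans (typeOf_compFst hn).symm) hn rfl)

/-- An element of the domain of `p · p` over the element of `P_p(Ty)` given by `A` and `B`
amounts to a pair of terms `a : A` and `b : B[a]`. -/
theorem existsUnique_compDom {Γ : C} (A : M.TyIn Γ) (B : M.TyIn (M.ext Γ A)) (a : M.TmIn Γ)
    (ha : M.typeOf a = A) (b : M.TmIn Γ) (hb : M.typeOf b = tySub (instSub A a ha) B) :
    ∃! n : M.compDom.obj (op Γ), M.compMap.app (op Γ) n = polyMk A B ∧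
      M.compFst.app (op Γ) n = a ∧ M.compSnd.app (op Γ) n = b := by
  obtain ⟨n, ⟨hn₁, hn₂⟩, hn⟩ := (isPullback_presheaf_iff.1 M.isPullback_compSnd).2 Γ b
    (pullbackPair (polyMk A B) a ((polyType_polyMk A B).trans ha.symm))
    (hb.trans (comp_condition A B a ha).symm)
  refine ⟨n, ⟨?_, ?_, hn₁⟩, ?_⟩
  · exact (congrArg (((ChosenPullbacksAlong.mapPullbackAdj M.p).counit.app
      (M.polyObj M.Ty)).left.app (op Γ)) hn₂).trans (counit_pullbackPair _ _ _)
  · exact (congrArg (((ChosenPullbacksAlong.pullback M.p).obj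
      (M.polyObj M.Ty)).hom.app (op Γ)) hn₂).trans (hom_pullbackPair _ _ _)
  · rintro n' ⟨h₁, h₂, h₃⟩
    exact hn n' ⟨h₃, eq_pullbackPair _ h₁ h₂⟩

/-- The element of the domain of `p · p` given by types `A` and `B` and terms `a : A` and
`b : B[a]`. -/
noncomputable def compMk {Γ : C} (A : M.TyIn Γ) (B : M.TyIn (M.ext Γ A)) (a : M.TmIn Γ)
    (ha : M.typeOf a = A) (b : M.TmIn Γ) (hb : M.typeOf b = tySub (instSub A a ha) B) :
    M.compDom.obj (op Γ) :=
  (existsUnique_compDom A B a ha b hb).choose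

section

variable {Γ : C} (A : M.TyIn Γ) (B : M.TyIn (M.ext Γ A)) (a : M.TmIn Γ)
    (ha : M.typeOf a = A) (b : M.TmIn Γ) (hb : M.typeOf b = tySub (instSub A a ha) B)

theorem compMap_compMk : M.compMap.app (op Γ) (compMk A B a ha b hb) = polyMk A B :=
  (existsUnique_compDom A B a ha b hb).choose_spec.1.1

theorem compFst_compMk : M.compFst.app (op Γ) (compMk A B a ha b hb) = a :=
  (existsUnique_compDom A B a ha b hb).choose_spec.1.2.1

theorem compSnd_compMk : M.compSnd.app (op Γ) (compMk A B a ha b hb) = b :=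
  (existsUnique_compDom A B a ha b hb).choose_spec.1.2.2

variable {A B a b}

theorem eq_compMk {n : M.compDom.obj (op Γ)} (h₁ : M.compMap.app (op Γ) n = polyMk A B)
    (h₂ : M.compFst.app (op Γ) n = a) (h₃ : M.compSnd.app (op Γ) n = b) :
    n = compMk A B a ha b hb :=
  (existsUnique_compDom A B a ha b hb).unique ⟨h₁, h₂, h₃⟩
    ⟨compMap_compMk A B a ha b hb, compFst_compMk A B a ha b hb, compSnd_compMk A B a ha b hb⟩

end

theorem compMap_map {Δ Γ : C} (σ : Δ ⟶ Γ) {A : M.TyIn Γ} {B : M.TyIn (M.ext Γ A)}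
    {n : M.compDom.obj (op Γ)} (hn : M.compMap.app (op Γ) n = polyMk A B) :
    M.compMap.app (op Δ) (M.compDom.map σ.op n) =
      polyMk (tySub σ A) (tySub (liftSub σ A) B) :=
  (NatTrans.naturality_apply M.compMap σ.op n).trans
    ((congrArg ((M.polyObj M.Ty).left.map σ.op) hn).trans (map_polyMk σ A B))

theorem compFst_map {Δ Γ : C} (σ : Δ ⟶ Γ) (n : M.compDom.obj (op Γ)) :
    M.compFst.app (op Δ) (M.compDom.map σ.op n) = tmSub σ (M.compFst.app (op Γ) n) :=
  NatTrans.naturality_apply M.compFst σ.op n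

theorem compSnd_map {Δ Γ : C} (σ : Δ ⟶ Γ) (n : M.compDom.obj (op Γ)) :
    M.compSnd.app (op Δ) (M.compDom.map σ.op n) = tmSub σ (M.compSnd.app (op Γ) n) :=
  NatTrans.naturality_apply M.compSnd σ.op n

theorem map_compMk {Δ Γ : C} (σ : Δ ⟶ Γ) (A : M.TyIn Γ) (B : M.TyIn (M.ext Γ A)) (a : M.TmIn Γ)
    (ha : M.typeOf a = A) (b : M.TmIn Γ) (hb : M.typeOf b = tySub (instSub A a ha) B) :
    M.compDom.map σ.op (compMk A B a ha b hb) =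
      compMk (tySub σ A) (tySub (liftSub σ A) B) (tmSub σ a) (typeOf_tmSub_eq σ ha)
        (tmSub σ b) (typeOf_tmSub_inst σ ha hb) :=
  eq_compMk _ _ (compMap_map σ (compMap_compMk A B a ha b hb))
    ((compFst_map σ _).trans (congrArg (tmSub σ) (compFst_compMk A B a ha b hb)))
    ((compSnd_map σ _).trans (congrArg (tmSub σ) (compSnd_compMk A B a ha b hb)))

end Composite

/-! ### Dependent sum types -/

namespace SigmaTypes

variable (S : M.SigmaTypes)

theorem pair_congr {Γ : C} (A : M.TyIn Γ) (B : M.TyIn (M.ext Γ A)) {a a' : M.TmIn Γ} (h : a = a')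
    (ha : M.typeOf a = A) {b b' : M.TmIn Γ} (h' : b = b')
    (hb : M.typeOf b = tySub (instSub A a ha) B) :
    S.pair A B a ha b hb = S.pair A B a' (h ▸ ha) b' (by subst h h'; exact hb) := by
  subst h h'; rfl

theorem fst_congr {Γ : C} (A : M.TyIn Γ) (B : M.TyIn (M.ext Γ A)) {c c' : M.TmIn Γ} (h : c = c')
    (hc : M.typeOf c = S.sigma A B) : S.fst A B c hc = S.fst A B c' (h ▸ hc) := by
  subst h; rfl

theorem snd_congr {Γ : C} (A : M.TyIn Γ) (B : M.TyIn (M.ext Γ A)) {c c' : M.TmIn Γ} (h : c = c')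
    (hc : M.typeOf c = S.sigma A B) : S.snd A B c hc = S.snd A B c' (h ▸ hc) := by
  subst h; rfl

variable [LocallyCartesianClosed (Cᵒᵖ ⥤ Type u)]

/-- The formation rule as a map `P_p(Ty) ⟶ Ty`. -/
noncomputable def sigmaMap : (M.polyObj M.Ty).left ⟶ M.Ty :=
  polyDesc S.sigma S.sigma_sub

theorem sigmaMap_polyMk {Γ : C} (A : M.TyIn Γ) (B : M.TyIn (M.ext Γ A)) :
    S.sigmaMap.app (op Γ) (polyMk A B) = S.sigma A B :=
  polyDesc_polyMk _ _ _ _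

/-- The pairing of the two terms that an element of the domain of `p · p` consists of. -/
noncomputable def pairComponents {Γ : C} (A : M.TyIn Γ) (B : M.TyIn (M.ext Γ A))
    (n : M.compDom.obj (op Γ)) (hn : M.compMap.app (op Γ) n = polyMk A B) : M.TmIn Γ :=
  S.pair A B (M.compFst.app (op Γ) n) (typeOf_compFst hn) (M.compSnd.app (op Γ) n)
    (typeOf_compSnd hn)

/-- The pairing does not depend on how the element below is presented by types `A` and `B`. -/
theorem pairComponents_congr {Γ : C} {A A' : M.TyIn Γ} {B : M.TyIn (M.ext Γ A)}
    {B' : M.TyIn (M.ext Γ A')} (n : M.compDom.obj (op Γ))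
    (hn : M.compMap.app (op Γ) n = polyMk A B) (hn' : M.compMap.app (op Γ) n = polyMk A' B') :
    S.pairComponents A B n hn = S.pairComponents A' B' n hn' := by
  have h : polyMk A B = polyMk A' B' := hn.symm.trans hn'
  obtain rfl : A = A' := by rw [← polyType_polyMk A B, h, polyType_polyMk]
  obtain rfl := polyMk_injective A h
  rfl

/-- The pairing rule as a map from the domain of `p · p` to the terms. -/
noncomputable def pairMap : M.compDom ⟶ M.Tm where
  app Γ := TypeCat.ofHom fun n ↦ S.pairComponents (Γ := Γ.unop) _ _ n
    (polyMk_polyBody (M.compMap.app Γ n) _ rfl).symm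
  naturality := by
    rintro ⟨Γ⟩ ⟨Δ⟩ ⟨σ : Δ ⟶ Γ⟩
    ext n
    refine (S.pairComponents_congr _ (polyMk_polyBody (M.compMap.app (op Δ) _) _ rfl).symm
      (compMap_map σ (polyMk_polyBody (M.compMap.app (op Γ) n) _ rfl).symm)).trans ?_
    refine Eq.trans ?_ (S.pair_sub σ _ _ _ _ _ _).symm
    exact S.pair_congr _ _ (compFst_map σ n) _ (compSnd_map σ n) _

theorem pairMap_app {Γ : C} {A : M.TyIn Γ} {B : M.TyIn (M.ext Γ A)}
    {n : M.compDom.obj (op Γ)} (hn : M.compMap.app (op Γ) n = polyMk A B) :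
    S.pairMap.app (op Γ) n = S.pair A B (M.compFst.app (op Γ) n) (typeOf_compFst hn)
      (M.compSnd.app (op Γ) n) (typeOf_compSnd hn) :=
  S.pairComponents_congr n (polyMk_polyBody (M.compMap.app (op Γ) n) _ rfl).symm hn

/-- Dependent sum types make the square of the middle map of `p · p`, `p`, formation and pairing a
pullback: the unique preimage of a term `c : Σ(A, B)` consists of its two projections. -/
theorem isPullback : IsPullback M.compMap S.pairMap S.sigmaMap M.p := by
  refine isPullback_presheaf_iff.2 ⟨?_, fun Γ w c hc ↦ ?_⟩
  · ext ⟨Γ⟩ n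
    obtain ⟨A, B, hn⟩ := exists_eq_polyMk (M.compMap.app (op Γ) n)
    refine (congrArg (S.sigmaMap.app (op Γ)) hn).trans ?_
    refine (S.sigmaMap_polyMk A B).trans ?_
    exact ((congrArg (M.p.app (op Γ)) (S.pairMap_app hn)).trans
      (S.typeOf_pair _ _ _ _ _ _)).symm
  · obtain ⟨A, B, rfl⟩ := exists_eq_polyMk w
    have hc : M.typeOf c = S.sigma A B := hc.symm.trans (S.sigmaMap_polyMk A B)
    refine ⟨compMk A B (S.fst A B c hc) (S.typeOf_fst A B c hc) (S.snd A B c hc)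
      (S.typeOf_snd A B c hc), ⟨compMap_compMk _ _ _ _ _ _, ?_⟩, ?_⟩
    · refine (S.pairMap_app (compMap_compMk _ _ _ _ _ _)).trans (Eq.trans ?_ (S.eta A B c hc))
      exact S.pair_congr A B (compFst_compMk _ _ _ _ _ _) _ (compSnd_compMk _ _ _ _ _ _) _
    · rintro n ⟨hn, hn'⟩
      have hp := (S.pairMap_app hn).symm.trans hn'
      refine eq_compMk _ _ hn ?_ ?_
      · exact (S.fst_pair A B _ (typeOf_compFst hn) _ (typeOf_compSnd hn)).symm.trans
          (S.fst_congr A B hp _)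
      · exact (S.snd_pair A B _ (typeOf_compFst hn) _ (typeOf_compSnd hn)).symm.trans
          (S.snd_congr A B hp _)

end SigmaTypes

section SigmaTypesOfIsPullback

variable [LocallyCartesianClosed (Cᵒᵖ ⥤ Type u)] {φ : (M.polyObj M.Ty).left ⟶ M.Ty}
  {ψ : M.compDom ⟶ M.Tm}

/-- The inverse of pairing: the unique element of the domain of `p · p` over `A` and `B` whose
pairing is `c`. -/
noncomputable def unpair (h : IsPullback M.compMap ψ φ M.p) {Γ : C} (A : M.TyIn Γ)
    (B : M.TyIn (M.ext Γ A)) (c : M.TmIn Γ) (hc : M.typeOf c = φ.app (op Γ) (polyMk A B)) :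
    M.compDom.obj (op Γ) :=
  ((isPullback_presheaf_iff.1 h).2 Γ (polyMk A B) c hc.symm).choose

theorem compMap_unpair (h : IsPullback M.compMap ψ φ M.p) {Γ : C} (A : M.TyIn Γ)
    (B : M.TyIn (M.ext Γ A)) (c : M.TmIn Γ) (hc : M.typeOf c = φ.app (op Γ) (polyMk A B)) :
    M.compMap.app (op Γ) (unpair h A B c hc) = polyMk A B :=
  ((isPullback_presheaf_iff.1 h).2 Γ (polyMk A B) c hc.symm).choose_spec.1.1

theorem pair_unpair (h : IsPullback M.compMap ψ φ M.p) {Γ : C} (A : M.TyIn Γ)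
    (B : M.TyIn (M.ext Γ A)) (c : M.TmIn Γ) (hc : M.typeOf c = φ.app (op Γ) (polyMk A B)) :
    ψ.app (op Γ) (unpair h A B c hc) = c :=
  ((isPullback_presheaf_iff.1 h).2 Γ (polyMk A B) c hc.symm).choose_spec.1.2

theorem eq_unpair (h : IsPullback M.compMap ψ φ M.p) {Γ : C} {A : M.TyIn Γ}
    {B : M.TyIn (M.ext Γ A)} {c : M.TmIn Γ} (hc : M.typeOf c = φ.app (op Γ) (polyMk A B))
    {n : M.compDom.obj (op Γ)} (h₁ : M.compMap.app (op Γ) n = polyMk A B)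
    (h₂ : ψ.app (op Γ) n = c) : n = unpair h A B c hc :=
  ((isPullback_presheaf_iff.1 h).2 Γ (polyMk A B) c hc.symm).unique ⟨h₁, h₂⟩
    ⟨compMap_unpair h A B c hc, pair_unpair h A B c hc⟩

theorem map_unpair (h : IsPullback M.compMap ψ φ M.p) {Δ Γ : C} (σ : Δ ⟶ Γ) (A : M.TyIn Γ)
    (B : M.TyIn (M.ext Γ A)) (c : M.TmIn Γ) (hc : M.typeOf c = φ.app (op Γ) (polyMk A B)) :
    M.compDom.map σ.op (unpair h A B c hc) =
      unpair h (tySub σ A) (tySub (liftSub σ A) B) (tmSub σ c)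
        ((typeOf_tmSub_eq σ hc).trans (formation_sub φ σ A B)) :=
  eq_unpair h _ (compMap_map σ (compMap_unpair h A B c hc))
    ((NatTrans.naturality_apply ψ σ.op _).trans (congrArg (tmSub σ) (pair_unpair h A B c hc)))

theorem typeOf_pair_of_isPullback (h : IsPullback M.compMap ψ φ M.p) {Γ : C} (A : M.TyIn Γ)
    (B : M.TyIn (M.ext Γ A)) (a : M.TmIn Γ) (ha : M.typeOf a = A) (b : M.TmIn Γ)
    (hb : M.typeOf b = tySub (instSub A a ha) B) :
    M.typeOf (ψ.app (op Γ) (compMk A B a ha b hb)) = φ.app (op Γ) (polyMk A B) :=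
  (ConcreteCategory.congr_hom (NatTrans.congr_app h.w (op Γ)) _).symm.trans
    (congrArg (φ.app (op Γ)) (compMap_compMk A B a ha b hb))

/-- The dependent sum types determined by a pullback square: the projections are the components of
the inverse of pairing. -/
noncomputable def SigmaTypes.ofIsPullback (h : IsPullback M.compMap ψ φ M.p) : M.SigmaTypes where
  sigma {Γ} A B := φ.app (op Γ) (polyMk A B)
  sigma_sub := formation_sub φ
  pair A B a ha b hb := ψ.app _ (compMk A B a ha b hb)
  typeOf_pair := typeOf_pair_of_isPullback h
  pair_sub {Δ _} σ A B a ha b hb := (NatTrans.naturality_apply ψ σ.op _).symm.trans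
    (congrArg (ψ.app (op Δ)) (map_compMk σ A B a ha b hb))
  fst A B c hc := M.compFst.app _ (unpair h A B c hc)
  typeOf_fst A B c hc := typeOf_compFst (compMap_unpair h A B c hc)
  fst_sub {Δ _} σ A B c hc := (compFst_map σ _).symm.trans
    (congrArg (M.compFst.app (op Δ)) (map_unpair h σ A B c hc))
  snd A B c hc := M.compSnd.app _ (unpair h A B c hc)
  typeOf_snd A B c hc := typeOf_compSnd (compMap_unpair h A B c hc)
  snd_sub {Δ _} σ A B c hc := (compSnd_map σ _).symm.trans
    (congrArg (M.compSnd.app (op Δ)) (map_unpair h σ A B c hc))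
  fst_pair {Γ} A B a ha b hb := (congrArg (M.compFst.app (op Γ)) (eq_unpair h _
    (compMap_compMk A B a ha b hb) rfl)).symm.trans (compFst_compMk A B a ha b hb)
  snd_pair {Γ} A B a ha b hb := (congrArg (M.compSnd.app (op Γ)) (eq_unpair h _
    (compMap_compMk A B a ha b hb) rfl)).symm.trans (compSnd_compMk A B a ha b hb)
  eta {Γ} A B c hc := (congrArg (ψ.app (op Γ)) (eq_compMk _ _
    (compMap_unpair h A B c hc) rfl rfl)).symm.trans (pair_unpair h A B c hc)

theorem supportsSigmaTypes_iff (M : NaturalModel C) : M.SupportsSigmaTypes ↔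
    ∃ (φ : (M.polyObj M.Ty).left ⟶ M.Ty) (ψ : M.compDom ⟶ M.Tm),
      IsPullback M.compMap ψ φ M.p :=
  ⟨fun ⟨S⟩ ↦ ⟨S.sigmaMap, S.pairMap, S.isPullback⟩, fun ⟨_, _, h⟩ ↦ ⟨SigmaTypes.ofIsPullback h⟩⟩

end SigmaTypesOfIsPullback

end NaturalModel

end NaturalModels

theorem mainTheorem4 {C : Type u} [SmallCategory.{u} C]
    [NaturalModels.LocallyCartesianClosed (Cᵒᵖ ⥤ Type u)] (M : NaturalModels.NaturalModel C) :
    (M.SupportsUnitTypes ↔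
      ∃ η : NaturalModels.Poly.Hom
          (NaturalModels.Poly.identity
            (NaturalModels.LocallyCartesianClosed.one : Cᵒᵖ ⥤ Type u))
          (NaturalModels.Poly.ofHom M.p),
        η.IsCartesian) ∧
    (M.SupportsSigmaTypes ↔
      ∃ μ : NaturalModels.Poly.Hom
          ((NaturalModels.Poly.ofHom M.p).comp (NaturalModels.Poly.ofHom M.p))
          (NaturalModels.Poly.ofHom M.p),
        μ.IsCartesian) ∧
    (M.SupportsPiTypes ↔
      ∃ ζ : NaturalModels.Poly.Hom
          (NaturalModels.Poly.ofHom ((NaturalModels.Poly.endofunctor M.p).map M.p))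
          (NaturalModels.Poly.ofHom M.p),
        ζ.IsCartesian) :=
  -- `M.compMap` and `(M.polyMap M.p).left` are by definition the middle map of `p · p` and `P_p(p)`.
  ⟨M.supportsUnitTypes_iff.trans (NaturalModels.Poly.exists_isCartesian_iff
      (NaturalModels.Poly.identity NaturalModels.LocallyCartesianClosed.one) M.p).symm,
    M.supportsSigmaTypes_iff.trans (NaturalModels.Poly.exists_isCartesian_iff
      ((NaturalModels.Poly.ofHom M.p).comp (NaturalModels.Poly.ofHom M.p)) M.p).symm,
    M.supportsPiTypes_iff.trans (NaturalModels.Poly.exists_isCartesian_iff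
      (NaturalModels.Poly.ofHom ((NaturalModels.Poly.endofunctor M.p).map M.p)) M.p).symm⟩
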